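/- Let $d\ge 1$, $\boldsymbol\nu=(\nu_1,\dots,\nu_d)\in\mathbb C^d$ and $\boldsymbol\varsigma=(\varsigma_1,\dots,\varsigma_{d+1})\in\{+,-\}^{d+1}$. Put $\theta(\boldsymbol t;\boldsymbol\varsigma)=\varsigma_{d+1}t_1\cdots t_d+\sum_{l=1}^d\varsigma_l t_l^{-1}$ and, for $x>0$, let $J_{\boldsymbol\nu}(x;\boldsymbol\varsigma)$ be the Bessel function given by the formal integral $\int_{\mathbb R_+^d}\prod_{l=1}^d t_l^{\nu_l-1}\,e^{ix\theta(\boldsymbol t;\boldsymbol\varsigma)}\,d\boldsymbol t$ in its rigorous interpretation, as follows. For weights $h(\boldsymbol t)=\prod_l h_l(t_l)$, where each $h_l$ is smooth on $\mathbb R_+$ with all $t^\alpha h_l^{(\alpha)}(t)$ bounded, write $J_{\boldsymbol\nu}(x;\boldsymbol\varsigma;h)=\int_{\mathbb R_+^d}h(\boldsymbol t)\prod_l t_l^{\nu_l-1}e^{ix\theta(\boldsymbol t;\boldsymbol\varsigma)}d\boldsymbol t$. With $\boldsymbol e_l$ the unit vectors and $\boldsymbol e^d=(1,\dots,1)$,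 define on formal linear combinations of the symbols $J_{\boldsymbol\nu'}(x;\boldsymbol\varsigma;h)$, $\boldsymbol\nu'\in\boldsymbol\nu+\mathbb Z^d$, with coefficients in $\mathbb C[x^{-1}]$ the $\mathbb C[x^{-1}]$-linear operators $$\mathcal P_{+,l}J_{\boldsymbol\nu}(h)=\varsigma_l\varsigma_{d+1}J_{\boldsymbol\nu+\boldsymbol e^d+\boldsymbol e_l}(h)-\varsigma_l i(\nu_l+1)x^{-1}J_{\boldsymbol\nu+\boldsymbol e_l}(h)-\varsigma_l i x^{-1}J_{\boldsymbol\nu+\boldsymbol e_l}(t_l\partial_l h),$$ $$\mathcal P_{-,l}J_{\boldsymbol\nu}(h)=\varsigma_l\varsigma_{d+1}J_{\boldsymbol\nu-\boldsymbol e^d-\boldsymbol e_l}(h)+\varsigma_{d+1}i(\nu_l-1)x^{-1}J_{\boldsymbol\nu-\boldsymbol e^d}(h)+\varsigma_{d+1}ix^{-1}J_{\boldsymbol\nu-\boldsymbol e^d}(t_l\partial_l h).$$ Let $\{h_\varrho\}_{\varrho\in I}$, with $I\supseteq\{+,-\}$ finite, be a partition of unity on $\mathbb R_+$ by such functions, with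 $h_-\equiv1$ near $0$ and $h_+\equiv 1$ near $\infty$; for $\boldsymbol\varrho\in I^d$ put $h_{\boldsymbol\varrho}(\boldsymbol t)=\prod_l h_{\varrho_l}(t_l)$ and $L_\pm=\{l:\varrho_l=\pm\}$. Let $A$ be an integer with $A\ge a+2$ for some $a$ with $|\operatorname{Re}\nu_l|<a$ for all $l$, and when $L_+\ne\emptyset$ choose $l_+\in L_+$. Transform the symbol $J_{\boldsymbol\nu}(h_{\boldsymbol\varrho})$ as follows. If $L_+=L_-=\emptyset$, leave it unchanged. If $L_+=\emptyset\ne L_-$, apply $\prod_{l\in L_-}\mathcal P_{+,l}^{A}$. If $L_-=\emptyset\neq L_+$, apply $\mathcal P_{-,l_+}^{A}$. If both are nonempty, apply $\prod_{l\in L_-}\mathcal P_{+,l}^{2A}$ and then, to each resulting symbol $J_{\boldsymbol\nu'}(h)$, the operator $\mathcal P_{-,l_+}^{A+k}$, where $k=\nu'_{l_+}-\nu_{l_+}\ge 0$. Then $J_{\boldsymbol\nu}(x;\boldsymbol\varsigma)$ is the sum over $\boldsymbol\varrho\in I^d$ of the values of the resulting combinations. Put $\mathfrak c=\max_l|\nu_l|+1$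 and $\mathfrak r=\max_l|\operatorname{Re}\nu_l|$, and suppose that some $\varsigma_l$ with $1\le l\le d$ differs from $\varsigma_{d+1}$. Then all the integrals occurring in $J_{\boldsymbol\nu}(x;\boldsymbol\varsigma)$ converge absolutely for $x>0$, $J_{\boldsymbol\nu}(x;\boldsymbol\varsigma)$ is smooth in $x>0$, and for all nonnegative integers $j$ and $M$ $$J^{(j)}_{\boldsymbol\nu}(x;\boldsymbol\varsigma)\ll_{\mathfrak r,M,j,d}\left(\frac{\mathfrak c}{x}\right)^M\qquad\text{for all }x\ge\mathfrak c,$$ where the derivative is in $x$ and the implied constant depends only on $\mathfrak r,M,j,d$ (in particular not on the choices of partition of unity, $A$ and $l_+$). In particular $J_{\boldsymbol\nu}(x;\boldsymbol\varsigma)$ is a Schwartz function at infinity: for all nonnegative integers $j,N$, $J^{(j)}_{\boldsymbol\nu}(x;\boldsymbol\varsigma)=O(x^{-N})$ as $x\to\infty$. -/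

import Mathlib

open Complex Polynomial Set MeasureTheory
open scoped ContDiff

noncomputable section

namespace FundBessel

/-- The value `±1` of a sign, as a complex number. -/
def sgn (s : ℤˣ) : ℂ := ((s : ℤ) : ℂ)

/-- The open orthant `ℝ₊ᵈ`. -/
def orthant (d : ℕ) : Set (Fin d → ℝ) := {t | ∀ l, 0 < t l}

/-- The phase `θ(t; ς) = ς_{d+1} t₁ ⋯ t_d + ∑ ς_l t_l⁻¹`. -/
def theta {d : ℕ} (ς : Fin (d + 1) → ℤˣ) (t : Fin d → ℝ) : ℂ :=
  sgn (ς (Fin.last d)) * ∏ l, (t l : ℂ) + ∑ l : Fin d, sgn (ς l.castSucc) * (t l : ℂ)⁻¹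

/-- The space `𝒯(ℝ₊)` of smooth `h` on `ℝ₊` such that every `t^α h^{(α)}(t)` is bounded. -/
def IsT (h : ℝ → ℂ) : Prop :=
  ContDiffOn ℝ ∞ h (Ioi 0) ∧
    ∀ α : ℕ, ∃ C : ℝ, ∀ t : ℝ, 0 < t → ‖(t : ℂ) ^ α * iteratedDeriv α h t‖ ≤ C

/-- The symbol of a `J`-integral `J_{ν + m}(x; ς; h)` whose index differs from `ν` by
`m = shift ∈ ℤᵈ` and whose weight is `h(t) = ∏ h_l(t_l)`, with `h_l = amp l`. -/
structure JSymbol (d : ℕ) where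
  shift : Fin d → ℤ
  amp : Fin d → ℝ → ℂ

/-- The integrand `h(t) p_{ν + m}(t) e^{i x θ(t; ς)}` of a `J`-integral, where
`p_μ(t) = ∏ t_l ^ (μ_l - 1)`. -/
def jIntegrand {d : ℕ} (ν : Fin d → ℂ) (ς : Fin (d + 1) → ℤˣ) (s : JSymbol d) (x : ℝ)
    (t : Fin d → ℝ) : ℂ :=
  (∏ l, s.amp l (t l)) * (∏ l, (t l : ℂ) ^ (ν l + (s.shift l : ℂ) - 1)) *
    Complex.exp (I * (x : ℂ) * theta ς t)

/-- The `J`-integral `J_{ν + m}(x; ς; h)` over `ℝ₊ᵈ`. -/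
def jIntegral {d : ℕ} (ν : Fin d → ℂ) (ς : Fin (d + 1) → ℤˣ) (s : JSymbol d) (x : ℝ) : ℂ :=
  ∫ t in orthant d, jIntegrand ν ς s x t

/-- Formal linear combinations of `J`-integrals with coefficients in `ℂ[x⁻¹]`; the variable `X`
of a coefficient polynomial stands for `x⁻¹`. -/
abbrev JSpace (d : ℕ) : Type := JSymbol d →₀ ℂ[X]

/-- The value at `x` of a formal linear combination of `J`-integrals. -/
def evalJ {d : ℕ} (ν : Fin d → ℂ) (ς : Fin (d + 1) → ℤˣ) (F : JSpace d) (x : ℝ) : ℂ :=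
  F.sum fun s p => p.eval ((x : ℂ)⁻¹) * jIntegral ν ς s x

/-- The replacement of the weight `h` by `t_l ∂_l h`. -/
def eulerAmp {d : ℕ} (l : Fin d) (h : Fin d → ℝ → ℂ) : Fin d → ℝ → ℂ :=
  Function.update h l fun t => (t : ℂ) * deriv (h l) t

/-- The unit vector `e_l`. -/
def unitVec {d : ℕ} (l : Fin d) : Fin d → ℤ := Pi.single l 1

/-- The formal partial integration of the first kind in `t_l`. For a symbol of index
`μ = ν + m` it is
`ς_l ς_{d+1} J_{μ+1+e_l}(h) - ς_l i (μ_l+1) x⁻¹ J_{μ+e_l}(h) - ς_l i x⁻¹ J_{μ+e_l}(t_l ∂_l h)`,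
where `1` is the all-ones vector. -/
def opPlus {d : ℕ} (ν : Fin d → ℂ) (ς : Fin (d + 1) → ℤˣ) (l : Fin d) :
    Module.End ℂ[X] (JSpace d) :=
  Finsupp.linearCombination ℂ[X] fun s =>
    Finsupp.single (⟨s.shift + 1 + unitVec l, s.amp⟩ : JSymbol d)
        (C (sgn (ς l.castSucc) * sgn (ς (Fin.last d))))
      - Finsupp.single (⟨s.shift + unitVec l, s.amp⟩ : JSymbol d)
        (C (sgn (ς l.castSucc) * I * (ν l + (s.shift l : ℂ) + 1)) * X)
      - Finsupp.single (⟨s.shift + unitVec l, eulerAmp l s.amp⟩ : JSymbol d)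
        (C (sgn (ς l.castSucc) * I) * X)

/-- The formal partial integration of the second kind in `t_l`. For a symbol of index
`μ = ν + m` it is
`ς_l ς_{d+1} J_{μ-1-e_l}(h) + ς_{d+1} i (μ_l-1) x⁻¹ J_{μ-1}(h) + ς_{d+1} i x⁻¹ J_{μ-1}(t_l ∂_l h)`.
-/
def opMinus {d : ℕ} (ν : Fin d → ℂ) (ς : Fin (d + 1) → ℤˣ) (l : Fin d) :
    Module.End ℂ[X] (JSpace d) :=
  Finsupp.linearCombination ℂ[X] fun s =>
    Finsupp.single (⟨s.shift - 1 - unitVec l, s.amp⟩ : JSymbol d)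
        (C (sgn (ς l.castSucc) * sgn (ς (Fin.last d))))
      + Finsupp.single (⟨s.shift - 1, s.amp⟩ : JSymbol d)
        (C (sgn (ς (Fin.last d)) * I * (ν l + (s.shift l : ℂ) - 1)) * X)
      + Finsupp.single (⟨s.shift - 1, eulerAmp l s.amp⟩ : JSymbol d)
        (C (sgn (ς (Fin.last d)) * I) * X)

/-- Applies the `(A + m_l)`-th power of `opMinus ν ς l` to each symbol of index `ν + m`
(used only for `m_l ≥ 0`). -/
def opMinusLevel {d : ℕ} (ν : Fin d → ℂ) (ς : Fin (d + 1) → ℤˣ) (A : ℕ) (l : Fin d) :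
    Module.End ℂ[X] (JSpace d) :=
  Finsupp.linearCombination ℂ[X] fun s =>
    (opMinus ν ς l ^ (A + (s.shift l).toNat)) (Finsupp.single s 1)

/-- The choices that enter the rigorous interpretation of the formal integral `J_ν(x; ς)`:
a finite smooth partition of unity `{h_ϱ}` on `ℝ₊` inside `𝒯(ℝ₊)`, with `h_- = 1` near zero and
`h_+ = 1` near infinity; an integer `A` with `A ≥ a + 2` for some `a` such that all
`|Re ν_l| < a`; and for every `ϱ ∈ Iᵈ` with some entry `+` the choice of such an entry. -/
structure Choices {d : ℕ} (ν : Fin d → ℂ) (I : Type) [Fintype I] where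
  minus : I
  plus : I
  minus_ne_plus : minus ≠ plus
  h : I → ℝ → ℝ
  h_nonneg : ∀ ϱ t, 0 < t → 0 ≤ h ϱ t
  h_sum : ∀ t, 0 < t → ∑ ϱ, h ϱ t = 1
  h_mem : ∀ ϱ, IsT fun t => (h ϱ t : ℂ)
  h_minus : ∃ δ : ℝ, 0 < δ ∧ ∀ t, 0 < t → t < δ → h minus t = 1
  h_plus : ∃ T : ℝ, ∀ t, T < t → h plus t = 1
  A : ℕ
  A_large : ∃ a : ℝ, (∀ l, |(ν l).re| < a) ∧ a + 2 ≤ A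
  lplus : (ϱ : Fin d → I) → (∃ l, ϱ l = plus) → Fin d
  lplus_mem : ∀ (ϱ : Fin d → I) (hϱ : ∃ l, ϱ l = plus), ϱ (lplus ϱ hϱ) = plus

open Classical in
/-- The operator `∏ opPlus l` over all `l` with `ϱ_l = -` (the factors commute). -/
def opPlusProd {d : ℕ} {ν : Fin d → ℂ} {I : Type} [Fintype I] (R : Choices ν I)
    (ς : Fin (d + 1) → ℤˣ) (ϱ : Fin d → I) : Module.End ℂ[X] (JSpace d) :=
  (List.ofFn fun l => if ϱ l = R.minus then opPlus ν ς l else 1).prod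

/-- The symbol of `J_ν(x; ς; ϱ) = J_ν(x; ς; h_ϱ)`, with `h_ϱ(t) = ∏ h_{ϱ_l}(t_l)`. -/
def pieceSymbol {d : ℕ} {ν : Fin d → ℂ} {I : Type} [Fintype I] (R : Choices ν I)
    (ϱ : Fin d → I) : JSymbol d :=
  ⟨0, fun l t => (R.h (ϱ l) t : ℂ)⟩

open Classical in
/-- The formal linear combination of absolutely convergent `J`-integrals into which
`J_ν(x; ς; ϱ)` is transformed by formal partial integrations, according to whether `+` and `-`
occur in `ϱ`. If both occur, the power of the operator of the second kind depends on the
symbol to which it is applied: as the coordinate `l₊ = lplus ϱ` is not one where `ϱ` is `-`, the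
`l₊`-th entry of the shift counts how often the all-ones vector has been added to the index. -/
def pieceFormal {d : ℕ} {ν : Fin d → ℂ} {I : Type} [Fintype I] (R : Choices ν I)
    (ς : Fin (d + 1) → ℤˣ) (ϱ : Fin d → I) : JSpace d :=
  if hp : ∃ l, ϱ l = R.plus then
    if ∃ l, ϱ l = R.minus then
      opMinusLevel ν ς R.A (R.lplus ϱ hp)
        ((opPlusProd R ς ϱ ^ (2 * R.A)) (Finsupp.single (pieceSymbol R ϱ) 1))
    else
      (opMinus ν ς (R.lplus ϱ hp) ^ R.A) (Finsupp.single (pieceSymbol R ϱ) 1)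
  else
    if ∃ l, ϱ l = R.minus then
      (opPlusProd R ς ϱ ^ R.A) (Finsupp.single (pieceSymbol R ϱ) 1)
    else
      Finsupp.single (pieceSymbol R ϱ) 1

open Classical in
/-- The Bessel function `J_ν(x; ς)`, that is, the rigorous interpretation of the formal integral
`∫_{ℝ₊ᵈ} ∏ t_l ^ (ν_l - 1) e^{i x θ(t; ς)} dt`, for `x > 0`. -/
def besselJ {d : ℕ} {ν : Fin d → ℂ} {I : Type} [Fintype I] (R : Choices ν I)
    (ς : Fin (d + 1) → ℤˣ) (x : ℝ) : ℂ :=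
  ∑ ϱ : Fin d → I, evalJ ν ς (pieceFormal R ς ϱ) x

/-- `𝔠 = max |ν_l| + 1`. -/
def frakC {d : ℕ} (ν : Fin d → ℂ) : ℝ := (⨆ l, ‖ν l‖) + 1

/-- `𝔯 = max |Re ν_l|`. -/
def frakR {d : ℕ} (ν : Fin d → ℂ) : ℝ := ⨆ l, |(ν l).re|

end FundBessel

end

/-!
The Bessel function is an absolutely convergent integral over a rotated orthant, from which all
claims can be read off.

In the coordinates `u = log t` the orthant becomes `ℝᵈ`, the Euler operators `t_l ∂_l` become
`∂ / ∂u_l`, and the integrand of `J_ν(x; ς)` becomes `exp (∑ ν_l u_l - x Φ)` with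
`Φ = -iς_{d+1} e^{u_1 + ⋯ + u_d} - ∑ iς_l e^{-u_l}`. Rotate the coefficient `-iς` of each term to
`-iς e^{iςφ}` (`rotCoeff`), whose real part is `sin φ`. If all angles lie in `(0, π)`, the integrand
decays like `exp (-κ exp (‖u‖ / d))` by `exp_norm_le_phaseSize`, so every integral converges, and
partial integration (`rotIntegral_eulerAmp`) is legitimate.

Identification of `J_ν(x; ς)`. Give all terms the same small angle `ε > 0`. The formal partial
integrations, with their coefficients deformed accordingly, then preserve values
(`rotValue_genPiece`), and the pieces of the partition of unity sum to the integral without weight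
(`sum_rotIntegral_piece`). The coefficients are continuous in `ε`, and the symbols that finally
remain have integrands that are absolutely integrable at `ε = 0` (`genPiece_mem_supported`), so
dominated convergence shows that `J_ν(x; ς)` is the limit of the integral without weight as
`ε → 0+` (`tendsto_rotIntegral_besselJ`). To treat the formal combinations at `ε = 0` and at
`ε > 0` together, the partial integrations are defined over an arbitrary commutative `ℂ`-algebra:
`ℂ[X]` gives the operators of the definition, `C(ℝ, ℂ)` the deformation in `ε`, and `ℂ` the
values.

Rotation. Translating `u` by an imaginary vector changes the angles of the terms, the angle of the
product `t₁ ⋯ t_d` being determined by those of the variables, and multiplies the integral by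
`rotFactor`; this holds since the derivative along the translation is a sum of integrals of
`u_l`-derivatives (`hasDerivAt_integral_rotKernel_angle`). If some `ς_l` differs from `ς_{d+1}`,
there are translations for which all angles become positive, of any prescribed small size `δ`
(`exists_compatible_angles`). Hence `ε` may tend to `0` under the rotated integral sign
(`besselJ_eq_rotFactor_mul`).

Estimate. With `δ` of size `1 / 𝔠` the factor `rotFactor` is bounded in terms of `d`, while the
exponential decays like `exp (-c (x / 𝔠) (t₁ ⋯ t_d + ∑ t_l⁻¹))` with `c` depending on `d` only.
As both `x / 𝔠` and the sum in parentheses are at least `1`, half of this decay gives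
`exp (-c (x / 𝔠) / 2)` and the other half a convergent integral that depends only on `𝔯`, `d` and
the number of `x`-derivatives (`norm_iteratedDeriv_besselJ_le`).
-/

noncomputable section

namespace FundBessel

open Filter Topology

/-! ### Rotated phases -/

/-- The coefficient `-iς e^{iςφ}`: the value `-iς` occurring in `-iθ`, rotated by the angle `φ`
towards the positive reals. Its real part is `sin φ`. -/
def rotCoeff (s : ℤˣ) (φ : ℝ) : ℂ := -(I * sgn s) * cexp (I * sgn s * φ)

/-- The inverse of `rotCoeff s φ`. -/
def rotCoeffInv (s : ℤˣ) (φ : ℝ) : ℂ := I * sgn s * cexp (-(I * sgn s * φ))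

lemma sgn_eq (s : ℤˣ) : sgn s = 1 ∨ sgn s = -1 := by
  rcases Int.units_eq_one_or s with rfl | rfl <;> simp [sgn]

lemma sgn_mul_self (s : ℤˣ) : sgn s * sgn s = 1 := by
  rcases sgn_eq s with h | h <;> simp [h]

lemma rotCoeffInv_mul_rotCoeff (s : ℤˣ) (φ : ℝ) : rotCoeffInv s φ * rotCoeff s φ = 1 := by
  have h : cexp (-(I * sgn s * φ)) * cexp (I * sgn s * φ) = 1 := by
    rw [← Complex.exp_add]; simp
  unfold rotCoeff rotCoeffInv
  linear_combination (-(I * I) * (sgn s * sgn s)) * h - (I * I) * sgn_mul_self s - I_mul_I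

lemma rotCoeff_re (s : ℤˣ) (φ : ℝ) : (rotCoeff s φ).re = Real.sin φ := by
  unfold rotCoeff
  rcases sgn_eq s with h | h <;> simp [h, Complex.exp_re, Complex.exp_im]

lemma norm_rotCoeff (s : ℤˣ) (φ : ℝ) : ‖rotCoeff s φ‖ = 1 := by
  unfold rotCoeff
  rcases sgn_eq s with h | h <;> simp [h, Complex.norm_exp]

lemma rotCoeff_zero (s : ℤˣ) : rotCoeff s 0 = -(I * sgn s) := by simp [rotCoeff]

lemma rotCoeffInv_zero (s : ℤˣ) : rotCoeffInv s 0 = I * sgn s := by simp [rotCoeffInv]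

@[fun_prop]
lemma continuous_rotCoeff (s : ℤˣ) : Continuous (rotCoeff s) := by
  unfold rotCoeff; fun_prop

@[fun_prop]
lemma continuous_rotCoeffInv (s : ℤˣ) : Continuous (rotCoeffInv s) := by
  unfold rotCoeffInv; fun_prop

lemma hasDerivAt_rotCoeff (s : ℤˣ) (φ : ℝ) :
    HasDerivAt (rotCoeff s) (I * sgn s * rotCoeff s φ) φ := by
  have h : HasDerivAt (fun φ : ℝ => I * sgn s * (φ : ℂ)) (I * sgn s * 1) φ :=
    (Complex.ofRealCLM.hasDerivAt (x := φ)).const_mul _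
  convert! h.cexp.const_mul (-(I * sgn s)) using 1
  unfold rotCoeff
  ring

variable {d : ℕ}

/-- The phase `-iθ` in the coordinates `u = log t`, with the coefficient of the `l`-th term rotated
by the angle `φ l`. -/
def rotPhase (ς : Fin (d + 1) → ℤˣ) (φ : Fin (d + 1) → ℝ) (u : Fin d → ℝ) : ℂ :=
  rotCoeff (ς (Fin.last d)) (φ (Fin.last d)) * cexp (∑ l, (u l : ℂ)) +
    ∑ l : Fin d, rotCoeff (ς l.castSucc) (φ l.castSucc) * cexp (-(u l : ℂ))

/-- The product of the power function and the exponential in a `J`-integral, in the coordinates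
`u = log t` and with rotated phase. -/
def rotKernel (ν : Fin d → ℂ) (ς : Fin (d + 1) → ℤˣ) (φ : Fin (d + 1) → ℝ) (x : ℝ)
    (u : Fin d → ℝ) : ℂ :=
  cexp (∑ l, ν l * (u l : ℂ) - x * rotPhase ς φ u)

/-- The sum `t₁ ⋯ t_d + ∑ t_l⁻¹` of the sizes of the terms of the phase, in the coordinates
`u = log t`. -/
def phaseSize (u : Fin d → ℝ) : ℝ := Real.exp (∑ l, u l) + ∑ l, Real.exp (-u l)

@[fun_prop]
lemma continuous_rotPhase (ς : Fin (d + 1) → ℤˣ) (φ : Fin (d + 1) → ℝ) :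
    Continuous (rotPhase ς φ) := by
  unfold rotPhase; fun_prop

@[fun_prop]
lemma continuous_rotKernel (ν : Fin d → ℂ) (ς : Fin (d + 1) → ℤˣ) (φ : Fin (d + 1) → ℝ) (x : ℝ) :
    Continuous (rotKernel ν ς φ x) := by
  unfold rotKernel; fun_prop

@[fun_prop]
lemma continuous_phaseSize : Continuous (phaseSize (d := d)) := by
  unfold phaseSize; fun_prop

lemma continuous_rotPhase_angle (ς : Fin (d + 1) → ℤˣ) (u : Fin d → ℝ) :
    Continuous fun φ => rotPhase ς φ u := by
  unfold rotPhase; fun_prop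

lemma continuous_rotKernel_angle (ν : Fin d → ℂ) (ς : Fin (d + 1) → ℤˣ) (x : ℝ) (u : Fin d → ℝ) :
    Continuous fun φ => rotKernel ν ς φ x u := by
  have := continuous_rotPhase_angle ς u
  unfold rotKernel; fun_prop

lemma rotPhase_re (ς : Fin (d + 1) → ℤˣ) (φ : Fin (d + 1) → ℝ) (u : Fin d → ℝ) :
    (rotPhase ς φ u).re = Real.sin (φ (Fin.last d)) * Real.exp (∑ l, u l) +
      ∑ l : Fin d, Real.sin (φ l.castSucc) * Real.exp (-u l) := by
  have h1 : cexp (∑ l, (u l : ℂ)) = ((Real.exp (∑ l, u l) : ℝ) : ℂ) := by push_cast; rfl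
  have h2 : ∀ l, cexp (-(u l : ℂ)) = ((Real.exp (-u l) : ℝ) : ℂ) := fun l => by push_cast; rfl
  simp only [rotPhase, h1, h2, add_re, re_sum, re_mul_ofReal, rotCoeff_re]

lemma mul_phaseSize_le_rotPhase_re (ς : Fin (d + 1) → ℤˣ) {φ : Fin (d + 1) → ℝ} {κ : ℝ}
    (hφ : ∀ l, κ ≤ Real.sin (φ l)) (u : Fin d → ℝ) :
    κ * phaseSize u ≤ (rotPhase ς φ u).re := by
  rw [rotPhase_re, phaseSize, mul_add, Finset.mul_sum]
  gcongr <;> apply hφ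

lemma norm_rotPhase_le (ς : Fin (d + 1) → ℤˣ) (φ : Fin (d + 1) → ℝ) (u : Fin d → ℝ) :
    ‖rotPhase ς φ u‖ ≤ phaseSize u := by
  have h1 : cexp (∑ l, (u l : ℂ)) = ((Real.exp (∑ l, u l) : ℝ) : ℂ) := by push_cast; rfl
  have h2 : ∀ l, cexp (-(u l : ℂ)) = ((Real.exp (-u l) : ℝ) : ℂ) := fun l => by push_cast; rfl
  unfold rotPhase phaseSize
  refine (norm_add_le _ _).trans (add_le_add ?_ ((norm_sum_le _ _).trans (Finset.sum_le_sum ?_)))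
  · rw [norm_mul, norm_rotCoeff, h1, norm_real, Real.norm_of_nonneg (Real.exp_pos _).le, one_mul]
  · intro l _
    rw [norm_mul, norm_rotCoeff, h2, norm_real, Real.norm_of_nonneg (Real.exp_pos _).le, one_mul]

lemma norm_rotKernel (ν : Fin d → ℂ) (ς : Fin (d + 1) → ℤˣ) (φ : Fin (d + 1) → ℝ) (x : ℝ)
    (u : Fin d → ℝ) :
    ‖rotKernel ν ς φ x u‖ = Real.exp (∑ l, (ν l).re * u l - x * (rotPhase ς φ u).re) := by
  simp [rotKernel, Complex.norm_exp]

/-! ### Growth of the phase and integrable majorants -/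

lemma phaseSize_pos (u : Fin d → ℝ) : 0 < phaseSize u :=
  add_pos_of_pos_of_nonneg (Real.exp_pos _) (Finset.sum_nonneg fun _ _ => (Real.exp_pos _).le)

/-- The terms of the phase cannot all be small: if every `-u_l` and `∑ u_l` were below `‖u‖ / d`,
then every `|u_l|` would be below `‖u‖`. -/
lemma exp_norm_le_phaseSize (u : Fin d → ℝ) : Real.exp (‖u‖ / d) ≤ phaseSize u := by
  rcases Nat.eq_zero_or_pos d with rfl | hd
  · simp [phaseSize]
  have hd' : (0 : ℝ) < d := by exact_mod_cast hd
  have hd1 : (1 : ℝ) ≤ d := by exact_mod_cast hd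
  by_contra! hlt
  set m := ‖u‖ / d with hm
  have hmd : d * m = ‖u‖ := by rw [hm]; field_simp
  have hm0 : 0 ≤ m := by positivity
  have h1 : ∑ l, u l < m := by
    have : Real.exp (∑ l, u l) < Real.exp m := lt_of_le_of_lt
      (le_add_of_nonneg_right (Finset.sum_nonneg fun _ _ => (Real.exp_pos _).le)) hlt
    exact Real.exp_lt_exp.1 this
  have h2 : ∀ l, -u l < m := fun l => by
    have h3 : Real.exp (-u l) ≤ ∑ l, Real.exp (-u l) :=
      Finset.single_le_sum (f := fun l => Real.exp (-u l)) (fun _ _ => (Real.exp_pos _).le)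
        (Finset.mem_univ l)
    have : Real.exp (-u l) < Real.exp m :=
      lt_of_le_of_lt (h3.trans (le_add_of_nonneg_left (Real.exp_pos _).le)) hlt
    exact Real.exp_lt_exp.1 this
  have h3 : ∀ l, |u l| < ‖u‖ := fun l => by
    have h4 : u l + m ≤ ∑ k, (u k + m) :=
      Finset.single_le_sum (f := fun k => u k + m) (fun k _ => by linarith [h2 k])
        (Finset.mem_univ l)
    rw [Finset.sum_add_distrib] at h4
    simp only [Finset.sum_const, Finset.card_univ, Fintype.card_fin, nsmul_eq_mul] at h4
    rw [abs_lt]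
    constructor <;> nlinarith [h2 l]
  have h0 : 0 < ‖u‖ := (abs_nonneg _).trans_lt (h3 ⟨0, hd⟩)
  exact lt_irrefl _ ((pi_norm_lt_iff h0).2 h3)

lemma one_le_phaseSize (u : Fin d → ℝ) : 1 ≤ phaseSize u :=
  (Real.one_le_exp (by positivity)).trans (exp_norm_le_phaseSize u)

lemma abs_sum_mul_le {a : Fin d → ℝ} {r : ℝ} (ha : ∀ l, |a l| ≤ r) (u : Fin d → ℝ) :
    |∑ l, a l * u l| ≤ d * r * ‖u‖ := by
  refine (Finset.abs_sum_le_sum_abs _ _).trans ?_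
  have : ∀ l ∈ (Finset.univ : Finset (Fin d)), |a l * u l| ≤ r * ‖u‖ := fun l _ => by
    rw [abs_mul]
    exact mul_le_mul (ha l) (norm_le_pi_norm u l) (abs_nonneg _) ((abs_nonneg _).trans (ha l))
  refine (Finset.sum_le_card_nsmul _ _ _ this).trans (le_of_eq ?_)
  simp [mul_assoc]

lemma phaseSize_le_exp (u : Fin d → ℝ) : phaseSize u ≤ (d + 1) * Real.exp ((d + 1) * ‖u‖) := by
  have h1 : ∑ l, u l ≤ (d + 1) * ‖u‖ := by
    have := (le_abs_self _).trans (abs_sum_mul_le (a := fun _ => 1) (r := 1) (by simp) u)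
    simp only [one_mul, mul_one] at this
    linarith [norm_nonneg u]
  have h2 : ∀ l ∈ (Finset.univ : Finset (Fin d)),
      Real.exp (-u l) ≤ Real.exp ((d + 1) * ‖u‖) := fun l _ => by
    have h3 : -u l ≤ ‖u‖ := (neg_le_abs _).trans (norm_le_pi_norm u l)
    have h4 : 0 ≤ (d : ℝ) * ‖u‖ := by positivity
    exact Real.exp_le_exp.2 (by linarith)
  have h5 := Finset.sum_le_card_nsmul _ _ _ h2
  simp only [Finset.card_univ, Fintype.card_fin, nsmul_eq_mul] at h5
  have := Real.exp_le_exp.2 h1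
  unfold phaseSize
  linarith

lemma integrable_exp_neg_norm : Integrable fun u : Fin d → ℝ => Real.exp (-‖u‖) := by
  have h := (integrable_one_add_norm (E := Fin d → ℝ) (μ := volume) (r := (d + 1 : ℕ))
    (by simp)).const_mul ((d + 1).factorial * Real.exp 1)
  refine h.mono' (by fun_prop) (Eventually.of_forall fun u => ?_)
  have hpos : (0 : ℝ) < 1 + ‖u‖ := by positivity
  have h1 := Real.pow_div_factorial_le_exp (1 + ‖u‖) hpos.le (d + 1)
  rw [Real.norm_of_nonneg (Real.exp_pos _).le, Real.rpow_neg hpos.le, Real.rpow_natCast]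
  rw [div_le_iff₀ (by positivity), Real.exp_add] at h1
  rw [← div_eq_mul_inv, le_div_iff₀ (by positivity)]
  calc Real.exp (-‖u‖) * (1 + ‖u‖) ^ (d + 1)
      ≤ Real.exp (-‖u‖) * (Real.exp 1 * Real.exp ‖u‖ * (d + 1).factorial) := by gcongr
    _ = (Real.exp (-‖u‖) * Real.exp ‖u‖) * ((d + 1).factorial * Real.exp 1) := by ring
    _ = _ := by rw [← Real.exp_add]; simp

lemma integrable_exp_norm_sub_phaseSize (b : ℝ) {κ : ℝ} (hκ : 0 < κ) :
    Integrable fun u : Fin d → ℝ => Real.exp (b * ‖u‖ - κ * phaseSize u) := by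
  -- `κ * phaseSize u` is at least `c ‖u‖ ^ 2`, and `(b + 1) r - c r ^ 2 ≤ (b + 1) ^ 2 / (4 c)`.
  -- The denominator has `d + 1` instead of `d` to include the case `d = 0`.
  set c : ℝ := κ / (2 * (d + 1) ^ 2) with hc
  have hc0 : 0 < c := by positivity
  refine (integrable_exp_neg_norm.const_mul (Real.exp ((b + 1) ^ 2 / (4 * c)))).mono'
    (by fun_prop) (Eventually.of_forall fun u => ?_)
  rw [Real.norm_of_nonneg (Real.exp_pos _).le, ← Real.exp_add, Real.exp_le_exp]
  have h2 : ‖u‖ / (d + 1) ≤ ‖u‖ / d ∨ d = 0 := by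
    rcases Nat.eq_zero_or_pos d with h | h
    · exact Or.inr h
    · left
      have : (0 : ℝ) < d := by exact_mod_cast h
      gcongr
      linarith
  have h3 : (‖u‖ / (d + 1)) ^ 2 / 2 ≤ phaseSize u := by
    rcases h2 with h2 | h2
    · have h4 := Real.quadratic_le_exp_of_nonneg (x := ‖u‖ / (d + 1)) (by positivity)
      have h5 := (Real.exp_le_exp.2 h2).trans (exp_norm_le_phaseSize u)
      have : 0 ≤ ‖u‖ / (d + 1) := by positivity
      linarith
    · subst h2
      have : ‖u‖ = 0 := by simp [Subsingleton.elim u 0]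
      rw [this]
      simpa using (phaseSize_pos u).le
  have h6 : c * ‖u‖ ^ 2 ≤ κ * phaseSize u := by
    calc c * ‖u‖ ^ 2 = κ * ((‖u‖ / (d + 1)) ^ 2 / 2) := by rw [hc]; field_simp
      _ ≤ _ := by gcongr
  have h7 : (b + 1) * ‖u‖ - c * ‖u‖ ^ 2 ≤ (b + 1) ^ 2 / (4 * c) := by
    rw [le_div_iff₀ (by positivity)]
    nlinarith [sq_nonneg (b + 1 - 2 * c * ‖u‖)]
  linarith

lemma integrable_phaseSize_pow_mul_exp (j : ℕ) (b : ℝ) {κ : ℝ} (hκ : 0 < κ) :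
    Integrable fun u : Fin d → ℝ =>
      phaseSize u ^ j * Real.exp (b * ‖u‖ - κ * phaseSize u) := by
  refine ((integrable_exp_norm_sub_phaseSize (d := d) (b + j * (d + 1)) hκ).const_mul
    (((d : ℝ) + 1) ^ j)).mono' (by fun_prop) (Eventually.of_forall fun u => ?_)
  have h0 := (phaseSize_pos u).le
  rw [Real.norm_of_nonneg (by positivity)]
  calc phaseSize u ^ j * Real.exp (b * ‖u‖ - κ * phaseSize u)
      ≤ ((d + 1) * Real.exp ((d + 1) * ‖u‖)) ^ j * Real.exp (b * ‖u‖ - κ * phaseSize u) := by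
        gcongr; exact phaseSize_le_exp u
    _ = _ := by
        rw [mul_pow, ← Real.exp_nat_mul, mul_assoc, ← Real.exp_add]
        congr 2
        ring

lemma norm_rotKernel_le {ν : Fin d → ℂ} {r : ℝ} (hν : ∀ l, |(ν l).re| ≤ r)
    (ς : Fin (d + 1) → ℤˣ) {φ : Fin (d + 1) → ℝ} {κ : ℝ} (hφ : ∀ l, κ ≤ Real.sin (φ l))
    {x : ℝ} (hx : 0 ≤ x) (u : Fin d → ℝ) :
    ‖rotKernel ν ς φ x u‖ ≤ Real.exp (d * r * ‖u‖ - x * κ * phaseSize u) := by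
  rw [norm_rotKernel, Real.exp_le_exp]
  have h1 := (le_abs_self _).trans (abs_sum_mul_le hν u)
  have h2 := mul_le_mul_of_nonneg_left (mul_phaseSize_le_rotPhase_re ς hφ u) hx
  linarith

/-! ### The weights -/

lemma contDiffOn_iteratedDeriv {h : ℝ → ℂ} (hh : ContDiffOn ℝ ∞ h (Ioi 0)) (n : ℕ) :
    ContDiffOn ℝ ∞ (iteratedDeriv n h) (Ioi 0) := by
  induction n with
  | zero => simpa using hh
  | succ n ih =>
    rw [iteratedDeriv_succ]
    exact ((contDiffOn_infty_iff_deriv_of_isOpen isOpen_Ioi).1 ih).2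

lemma IsT.differentiableAt {h : ℝ → ℂ} (hh : IsT h) {t : ℝ} (ht : 0 < t) :
    DifferentiableAt ℝ h t :=
  (hh.1.differentiableOn (by simp)).differentiableAt (Ioi_mem_nhds ht)

lemma IsT.exists_bound {h : ℝ → ℂ} (hh : IsT h) : ∃ B : ℝ, ∀ t, 0 < t → ‖h t‖ ≤ B := by
  obtain ⟨B, hB⟩ := hh.2 0
  exact ⟨B, fun t ht => by simpa using hB t ht⟩

lemma isT_one : IsT fun _ => 1 := by
  refine ⟨contDiffOn_const, fun n => ?_⟩
  rcases n with _ | n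
  · exact ⟨1, fun t _ => by simp⟩
  · exact ⟨0, fun t _ => by simp [iteratedDeriv_const]⟩

/-- Leibniz' rule for `t h'`. -/
lemma iteratedDeriv_id_mul_deriv {h : ℝ → ℂ} (hh : ContDiffOn ℝ ∞ h (Ioi 0)) (n : ℕ) :
    ∀ t : ℝ, 0 < t → iteratedDeriv n (fun t : ℝ => (t : ℂ) * deriv h t) t =
      t * iteratedDeriv (n + 1) h t + n * iteratedDeriv n h t := by
  induction n with
  | zero => intro t _; simp [iteratedDeriv_one]
  | succ n ih =>
    intro t ht
    have hd : ∀ k, HasDerivAt (iteratedDeriv k h) (iteratedDeriv (k + 1) h t) t := fun k => by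
      rw [iteratedDeriv_succ]
      exact (((contDiffOn_iteratedDeriv hh k).differentiableOn (by simp)).differentiableAt
        (Ioi_mem_nhds ht)).hasDerivAt
    have he : iteratedDeriv n (fun t : ℝ => (t : ℂ) * deriv h t) =ᶠ[𝓝 t] fun t =>
        t * iteratedDeriv (n + 1) h t + n * iteratedDeriv n h t :=
      eventually_of_mem (Ioi_mem_nhds ht) ih
    have hid : HasDerivAt (fun t : ℝ => (t : ℂ)) 1 t := Complex.ofRealCLM.hasDerivAt
    rw [iteratedDeriv_succ, he.deriv_eq,
      ((hid.fun_mul (hd (n + 1))).fun_add ((hd n).const_mul (n : ℂ))).deriv]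
    push_cast
    ring

lemma IsT.euler {h : ℝ → ℂ} (hh : IsT h) : IsT fun t => (t : ℂ) * deriv h t := by
  refine ⟨?_, fun n => ?_⟩
  · exact ContDiffOn.mul Complex.ofRealCLM.contDiff.contDiffOn
      ((contDiffOn_infty_iff_deriv_of_isOpen isOpen_Ioi).1 hh.1).2
  · obtain ⟨B, hB⟩ := hh.2 (n + 1)
    obtain ⟨B', hB'⟩ := hh.2 n
    refine ⟨B + n * B', fun t ht => ?_⟩
    rw [iteratedDeriv_id_mul_deriv hh.1 n t ht]
    calc ‖(t : ℂ) ^ n * (t * iteratedDeriv (n + 1) h t + n * iteratedDeriv n h t)‖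
        = ‖(t : ℂ) ^ (n + 1) * iteratedDeriv (n + 1) h t +
            n * ((t : ℂ) ^ n * iteratedDeriv n h t)‖ := by ring_nf
      _ ≤ _ := by
          refine (norm_add_le _ _).trans (add_le_add (hB t ht) ?_)
          rw [norm_mul, Complex.norm_natCast]
          exact mul_le_mul_of_nonneg_left (hB' t ht) (Nat.cast_nonneg n)

lemma IsT.eulerAmp {h : Fin d → ℝ → ℂ} (hh : ∀ k, IsT (h k)) (l k : Fin d) :
    IsT (eulerAmp l h k) := by
  by_cases hkl : k = l
  · subst hkl
    simpa [FundBessel.eulerAmp] using (hh k).euler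
  · simpa [FundBessel.eulerAmp, hkl] using hh k

/-- The weight `∏ h_l(t_l)` in the coordinates `u = log t`. -/
def logAmp (h : Fin d → ℝ → ℂ) (u : Fin d → ℝ) : ℂ := ∏ l, h l (Real.exp (u l))

lemma IsT.continuous_comp_exp {h : ℝ → ℂ} (hh : IsT h) : Continuous fun u => h (Real.exp u) :=
  hh.1.continuousOn.comp_continuous Real.continuous_exp Real.exp_pos

lemma continuous_logAmp {h : Fin d → ℝ → ℂ} (hh : ∀ l, IsT (h l)) : Continuous (logAmp h) :=
  continuous_finsetProd _ fun l _ => (hh l).continuous_comp_exp.comp (continuous_apply l)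

lemma exists_norm_logAmp_le {h : Fin d → ℝ → ℂ} (hh : ∀ l, IsT (h l)) :
    ∃ B : ℝ, ∀ u, ‖logAmp h u‖ ≤ B := by
  choose B hB using fun l => (hh l).exists_bound
  refine ⟨∏ l, B l, fun u => ?_⟩
  rw [logAmp, norm_prod]
  exact Finset.prod_le_prod (fun _ _ => norm_nonneg _) fun l _ => hB l _ (Real.exp_pos _)

/-- In the coordinates `u = log t` the Euler operator `t_l ∂_l` is the derivative in `u_l`. -/
lemma hasLineDerivAt_logAmp {h : Fin d → ℝ → ℂ} (hh : ∀ l, IsT (h l)) (l : Fin d)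
    (u : Fin d → ℝ) :
    HasLineDerivAt ℝ (logAmp h) (logAmp (eulerAmp l h) u) u (Pi.single l 1) := by
  have h1 : HasDerivAt (fun t : ℝ => h l (Real.exp (u l + t)))
      ((Real.exp (u l) : ℂ) * deriv (h l) (Real.exp (u l))) 0 := by
    have h2 : HasDerivAt (fun t : ℝ => Real.exp (u l + t)) (Real.exp (u l)) 0 := by
      simpa using ((hasDerivAt_id (0 : ℝ)).const_add (u l)).exp
    have h3 := ((hh l).differentiableAt (Real.exp_pos (u l + 0))).hasDerivAt
    have h4 := HasDerivAt.scomp (0 : ℝ) h3 h2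
    simpa [Function.comp_def] using h4
  have h5 := h1.mul_const (∏ k ∈ Finset.univ.erase l, h k (Real.exp (u k)))
  unfold HasLineDerivAt
  convert! h5 using 1
  · funext t
    rw [logAmp, ← Finset.mul_prod_erase _ _ (Finset.mem_univ l)]
    congr 1
    · simp
    · refine Finset.prod_congr rfl fun k hk => ?_
      simp [Finset.ne_of_mem_erase hk]
  · rw [logAmp, ← Finset.mul_prod_erase _ _ (Finset.mem_univ l)]
    congr 1
    · simp [FundBessel.eulerAmp]
    · refine Finset.prod_congr rfl fun k hk => ?_
      simp [FundBessel.eulerAmp, Finset.ne_of_mem_erase hk]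

/-! ### Rotated integrals and partial integration -/

lemma rotKernel_add_one (μ : Fin d → ℂ) (ς : Fin (d + 1) → ℤˣ) (φ : Fin (d + 1) → ℝ) (x : ℝ)
    (u : Fin d → ℝ) :
    rotKernel (μ + 1) ς φ x u = cexp (∑ l, (u l : ℂ)) * rotKernel μ ς φ x u := by
  rw [rotKernel, rotKernel, ← Complex.exp_add]
  congr 1
  simp only [Pi.add_apply, Pi.one_apply, add_mul, one_mul, Finset.sum_add_distrib]
  ring

lemma rotKernel_sub_single (μ : Fin d → ℂ) (ς : Fin (d + 1) → ℤˣ) (φ : Fin (d + 1) → ℝ) (x : ℝ)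
    (l : Fin d) (u : Fin d → ℝ) :
    rotKernel (μ - Pi.single l 1) ς φ x u = cexp (-(u l : ℂ)) * rotKernel μ ς φ x u := by
  rw [rotKernel, rotKernel, ← Complex.exp_add]
  congr 1
  simp only [Pi.sub_apply, sub_mul, Finset.sum_sub_distrib, Pi.single_apply, ite_mul, one_mul,
    zero_mul, Finset.sum_ite_eq', Finset.mem_univ, if_true]
  ring

lemma hasLineDerivAt_rotKernel (μ : Fin d → ℂ) (ς : Fin (d + 1) → ℤˣ) (φ : Fin (d + 1) → ℝ)
    (x : ℝ) (l : Fin d) (u : Fin d → ℝ) :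
    HasLineDerivAt ℝ (rotKernel μ ς φ x)
      (μ l * rotKernel μ ς φ x u -
        x * rotCoeff (ς (Fin.last d)) (φ (Fin.last d)) * rotKernel (μ + 1) ς φ x u +
        x * rotCoeff (ς l.castSucc) (φ l.castSucc) * rotKernel (μ - Pi.single l 1) ς φ x u)
      u (Pi.single l 1) := by
  have hk : ∀ k, HasDerivAt (fun t : ℝ => (((u + t • (Pi.single l 1 : Fin d → ℝ)) k : ℝ) : ℂ))
      (if k = l then 1 else 0) 0 := fun k => by
    have h1 : HasDerivAt (fun t : ℝ => (u k : ℂ) + (t : ℂ) * (if k = l then 1 else 0))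
        (1 * if k = l then 1 else 0) 0 :=
      ((Complex.ofRealCLM.hasDerivAt (x := (0 : ℝ))).mul_const _).const_add _
    convert! h1 using 1
    · funext t
      by_cases hkl : k = l
      · subst hkl; simp
      · simp [hkl]
    · simp
  have h1 : HasDerivAt (fun t : ℝ => ∑ k, μ k * (((u + t • (Pi.single l 1 : Fin d → ℝ)) k : ℝ) : ℂ))
      (μ l) 0 := by
    simpa using HasDerivAt.fun_sum (u := Finset.univ) fun k _ => (hk k).const_mul (μ k)
  have h2 : HasDerivAt
      (fun t : ℝ => ∑ k, (((u + t • (Pi.single l 1 : Fin d → ℝ)) k : ℝ) : ℂ)) 1 0 := by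
    simpa using HasDerivAt.fun_sum (u := Finset.univ) fun k _ => hk k
  have h3 := HasDerivAt.fun_sum (u := Finset.univ) fun k _ =>
    (hk k).fun_neg.cexp.const_mul (rotCoeff (ς k.castSucc) (φ k.castSucc))
  have h4 := (h1.fun_sub (((h2.cexp.const_mul
    (rotCoeff (ς (Fin.last d)) (φ (Fin.last d)))).fun_add h3).const_mul (x : ℂ))).cexp
  unfold HasLineDerivAt
  rw [rotKernel_add_one, rotKernel_sub_single]
  convert! h4 using 1
  simp only [zero_smul, add_zero, mul_neg, mul_ite, mul_one, mul_zero,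
    Finset.sum_ite_eq', Finset.mem_univ, if_true, rotKernel, rotPhase,
    neg_ite, neg_zero]
  ring

/-- The `J`-integral with weight `h`, index `μ` and rotated phase, in the coordinates
`u = log t`. -/
def rotIntegral (h : Fin d → ℝ → ℂ) (μ : Fin d → ℂ) (ς : Fin (d + 1) → ℤˣ)
    (φ : Fin (d + 1) → ℝ) (x : ℝ) : ℂ :=
  ∫ u : Fin d → ℝ, logAmp h u * rotKernel μ ς φ x u

/-- A rotated phase with all angles in `(0, π)` makes every integral absolutely convergent. -/
lemma integrable_logAmp_mul_rotKernel {h : Fin d → ℝ → ℂ} (hh : ∀ l, IsT (h l)) (μ : Fin d → ℂ)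
    (ς : Fin (d + 1) → ℤˣ) {φ : Fin (d + 1) → ℝ} (hφ : ∀ l, 0 < Real.sin (φ l)) {x : ℝ}
    (hx : 0 < x) : Integrable fun u => logAmp h u * rotKernel μ ς φ x u := by
  obtain ⟨B, hB⟩ := exists_norm_logAmp_le hh
  obtain ⟨l₀, hl₀⟩ := Finite.exists_min fun l => Real.sin (φ l)
  have hν : ∀ l, |(μ l).re| ≤ ∑ k, |(μ k).re| := fun l =>
    Finset.single_le_sum (f := fun k => |(μ k).re|) (fun _ _ => abs_nonneg _) (Finset.mem_univ l)
  have hi := integrable_exp_norm_sub_phaseSize (d := d) (d * ∑ k, |(μ k).re|)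
    (mul_pos hx (hφ l₀))
  exact (hi.mono' (by fun_prop) (Eventually.of_forall
    (norm_rotKernel_le hν ς hl₀ hx.le))).bdd_mul
      (continuous_logAmp hh).aestronglyMeasurable (Eventually.of_forall hB)

/-- The partial integration in `u_l` that underlies both formal partial integrations. -/
lemma rotIntegral_eulerAmp {h : Fin d → ℝ → ℂ} (hh : ∀ l, IsT (h l)) (μ : Fin d → ℂ)
    (ς : Fin (d + 1) → ℤˣ) {φ : Fin (d + 1) → ℝ} (hφ : ∀ l, 0 < Real.sin (φ l)) {x : ℝ}
    (hx : 0 < x) (l : Fin d) :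
    rotIntegral (eulerAmp l h) μ ς φ x = -(μ l * rotIntegral h μ ς φ x -
        x * rotCoeff (ς (Fin.last d)) (φ (Fin.last d)) * rotIntegral h (μ + 1) ς φ x +
        x * rotCoeff (ς l.castSucc) (φ l.castSucc) *
          rotIntegral h (μ - Pi.single l 1) ς φ x) := by
  have i0 := fun μ => integrable_logAmp_mul_rotKernel hh μ ς hφ hx
  have i1 := integrable_logAmp_mul_rotKernel (IsT.eulerAmp hh l) μ ς hφ hx
  have i2 := (((i0 μ).const_mul (μ l)).sub ((i0 (μ + 1)).const_mul
    (x * rotCoeff (ς (Fin.last d)) (φ (Fin.last d))))).add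
    ((i0 (μ - Pi.single l 1)).const_mul (x * rotCoeff (ς l.castSucc) (φ l.castSucc)))
  have key := integral_bilinear_hasLineDerivAt_right_eq_neg_left_of_integrable
    (μ := (volume : Measure (Fin d → ℝ))) (f := logAmp h) (f' := logAmp (eulerAmp l h))
    (g := rotKernel μ ς φ x) (v := Pi.single l (1 : ℝ)) (B := ContinuousLinearMap.mul ℝ ℂ)
    i1 (i2.congr (Eventually.of_forall fun u => by
      simp only [Pi.add_apply, Pi.sub_apply, ContinuousLinearMap.mul_apply']; ring)) (i0 μ)
    (fun u _ => hasLineDerivAt_logAmp hh l u) (fun u _ => hasLineDerivAt_rotKernel μ ς φ x l u)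
  simp only [ContinuousLinearMap.mul_apply'] at key
  rw [rotIntegral, eq_neg_iff_add_eq_zero, add_comm, ← eq_neg_iff_add_eq_zero, ← key]
  simp only [rotIntegral, ← integral_const_mul]
  rw [← integral_sub, ← integral_add]
  · exact integral_congr_ae (Eventually.of_forall fun u => by ring)
  · exact ((i0 μ).const_mul (μ l)).sub ((i0 (μ + 1)).const_mul _)
  · exact (i0 _).const_mul _
  · exact (i0 _).const_mul _
  · exact (i0 _).const_mul _

/-! ### The change of variables `t = exp u` -/

lemma image_exp_univ : (fun (u : Fin d → ℝ) l => Real.exp (u l)) '' univ = orthant d := by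
  ext t
  simp only [image_univ, mem_range, orthant, mem_ofPred_eq]
  constructor
  · rintro ⟨u, rfl⟩ l
    exact Real.exp_pos _
  · exact fun ht => ⟨fun l => Real.log (t l), funext fun l => Real.exp_log (ht l)⟩

lemma hasFDerivAt_exp_pi (u : Fin d → ℝ) :
    HasFDerivAt (fun (u : Fin d → ℝ) l => Real.exp (u l))
      (Matrix.toLin' (Matrix.diagonal fun l => Real.exp (u l))).toContinuousLinearMap u := by
  refine hasFDerivAt_pi'.2 fun l => ?_
  have h : HasFDerivAt (fun u : Fin d → ℝ => u l) (ContinuousLinearMap.proj (R := ℝ) l) u :=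
    hasFDerivAt_apply (𝕜 := ℝ) l u
  convert! h.exp using 1
  ext v
  simp [Matrix.mulVec_diagonal]

lemma exp_injOn : InjOn (fun (u : Fin d → ℝ) l => Real.exp (u l)) univ := fun _ _ _ _ huv =>
  funext fun l => Real.exp_injective (congrFun huv l)

lemma abs_det_mul_jIntegrand (ν : Fin d → ℂ) (ς : Fin (d + 1) → ℤˣ) (s : JSymbol d) (x : ℝ)
    (u : Fin d → ℝ) :
    |(Matrix.toLin' (Matrix.diagonal fun l => Real.exp (u l))).toContinuousLinearMap.det| •
        jIntegrand ν ς s x (fun l => Real.exp (u l)) =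
      logAmp s.amp u * rotKernel (fun l => ν l + s.shift l) ς 0 x u := by
  have hdet : |(Matrix.toLin'
      (Matrix.diagonal fun l => Real.exp (u l))).toContinuousLinearMap.det| =
      ∏ l, Real.exp (u l) := by
    rw [LinearMap.det_toContinuousLinearMap, LinearMap.det_toLin', Matrix.det_diagonal,
      abs_of_pos (Finset.prod_pos fun _ _ => Real.exp_pos _)]
  have hpow : ∀ l, (Real.exp (u l) : ℂ) * (Real.exp (u l) : ℂ) ^ (ν l + (s.shift l : ℂ) - 1) =
      cexp ((ν l + s.shift l) * u l) := fun l => by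
    rw [Complex.cpow_def_of_ne_zero (by simp), ← Complex.ofReal_log (Real.exp_pos _).le,
      Real.log_exp, Complex.ofReal_exp, ← Complex.exp_add]
    congr 1
    ring
  have hth : I * (x : ℂ) * theta ς (fun l => Real.exp (u l)) = -(x * rotPhase ς 0 u) := by
    simp only [theta, rotPhase, Pi.zero_apply, rotCoeff_zero, Complex.ofReal_exp,
      ← Complex.exp_sum, ← Complex.exp_neg, neg_mul, Finset.sum_neg_distrib, mul_assoc,
      ← Finset.mul_sum]
    ring
  rw [hdet, jIntegrand, hth, rotKernel, sub_eq_add_neg, Complex.exp_add, Complex.exp_sum]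
  simp only [← hpow, Finset.prod_mul_distrib, logAmp, Complex.real_smul, Complex.ofReal_prod]
  ring

lemma jIntegral_eq_rotIntegral (ν : Fin d → ℂ) (ς : Fin (d + 1) → ℤˣ) (s : JSymbol d) (x : ℝ) :
    jIntegral ν ς s x = rotIntegral s.amp (fun l => ν l + s.shift l) ς 0 x := by
  rw [jIntegral, ← image_exp_univ, integral_image_eq_integral_abs_det_fderiv_smul volume
    MeasurableSet.univ (fun u _ => (hasFDerivAt_exp_pi u).hasFDerivWithinAt) exp_injOn]
  simp only [abs_det_mul_jIntegrand, Measure.restrict_univ, rotIntegral]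

lemma integrableOn_jIntegrand_iff (ν : Fin d → ℂ) (ς : Fin (d + 1) → ℤˣ) (s : JSymbol d)
    (x : ℝ) : IntegrableOn (jIntegrand ν ς s x) (orthant d) ↔
      Integrable fun u => logAmp s.amp u * rotKernel (fun l => ν l + s.shift l) ς 0 x u := by
  rw [← image_exp_univ, integrableOn_image_iff_integrableOn_abs_det_fderiv_smul volume
    MeasurableSet.univ (fun u _ => (hasFDerivAt_exp_pi u).hasFDerivWithinAt) exp_injOn]
  simp only [abs_det_mul_jIntegrand, integrableOn_univ]

/-! ### Formal partial integrations over a general coefficient algebra -/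

/-- The data from which the coefficients of the formal partial integrations are built: the
coefficients `num l` of the phase, their inverses `inv l`, and `y`, which stands for `x⁻¹`. -/
structure IBPCoeffs (d : ℕ) (K : Type) where
  num : Fin (d + 1) → K
  inv : Fin (d + 1) → K
  y : K

section Ops

variable {K L : Type} [CommRing K] [Algebra ℂ K] [CommRing L] [Algebra ℂ L]

/-- The image of coefficient data under a map of coefficient algebras. -/
def IBPCoeffs.map (c : IBPCoeffs d K) (f : K →ₐ[ℂ] L) : IBPCoeffs d L :=
  ⟨fun l => f (c.num l), fun l => f (c.inv l), f c.y⟩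

/-- The image of a symbol under `genPlus`. -/
def genPlusSymbol (ν : Fin d → ℂ) (c : IBPCoeffs d K) (l : Fin d) (s : JSymbol d) :
    JSymbol d →₀ K :=
  Finsupp.single ⟨s.shift + 1 + unitVec l, s.amp⟩ (c.inv l.castSucc * c.num (Fin.last d))
    - Finsupp.single ⟨s.shift + unitVec l, s.amp⟩
      (algebraMap ℂ K (ν l + (s.shift l : ℂ) + 1) * c.inv l.castSucc * c.y)
    - Finsupp.single ⟨s.shift + unitVec l, eulerAmp l s.amp⟩ (c.inv l.castSucc * c.y)

/-- The image of a symbol under `genMinus`. -/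
def genMinusSymbol (ν : Fin d → ℂ) (c : IBPCoeffs d K) (l : Fin d) (s : JSymbol d) :
    JSymbol d →₀ K :=
  Finsupp.single ⟨s.shift - 1 - unitVec l, s.amp⟩ (c.inv (Fin.last d) * c.num l.castSucc)
    + Finsupp.single ⟨s.shift - 1, s.amp⟩
      (algebraMap ℂ K (ν l + (s.shift l : ℂ) - 1) * c.inv (Fin.last d) * c.y)
    + Finsupp.single ⟨s.shift - 1, eulerAmp l s.amp⟩ (c.inv (Fin.last d) * c.y)

/-- The formal partial integration of the first kind, with general coefficient data. -/
def genPlus (ν : Fin d → ℂ) (c : IBPCoeffs d K) (l : Fin d) : Module.End K (JSymbol d →₀ K) :=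
  Finsupp.linearCombination K (genPlusSymbol ν c l)

/-- The formal partial integration of the second kind, with general coefficient data. -/
def genMinus (ν : Fin d → ℂ) (c : IBPCoeffs d K) (l : Fin d) : Module.End K (JSymbol d →₀ K) :=
  Finsupp.linearCombination K (genMinusSymbol ν c l)

/-- The analogue of `opMinusLevel` with general coefficient data. -/
def genMinusLevel (ν : Fin d → ℂ) (c : IBPCoeffs d K) (A : ℕ) (l : Fin d) :
    Module.End K (JSymbol d →₀ K) :=
  Finsupp.linearCombination K fun s =>
    (genMinus ν c l ^ (A + (s.shift l).toNat)) (Finsupp.single s 1)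

open Classical in
/-- The analogue of `opPlusProd` with general coefficient data. -/
def genPlusProd {ν : Fin d → ℂ} {I : Type} [Fintype I] (R : Choices ν I) (c : IBPCoeffs d K)
    (ϱ : Fin d → I) : Module.End K (JSymbol d →₀ K) :=
  (List.ofFn fun l => if ϱ l = R.minus then genPlus ν c l else 1).prod

open Classical in
/-- The analogue of `pieceFormal` with general coefficient data. -/
def genPiece {ν : Fin d → ℂ} {I : Type} [Fintype I] (R : Choices ν I) (c : IBPCoeffs d K)
    (ϱ : Fin d → I) : JSymbol d →₀ K :=
  if hp : ∃ l, ϱ l = R.plus then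
    if ∃ l, ϱ l = R.minus then
      genMinusLevel ν c R.A (R.lplus ϱ hp)
        ((genPlusProd R c ϱ ^ (2 * R.A)) (Finsupp.single (pieceSymbol R ϱ) 1))
    else
      (genMinus ν c (R.lplus ϱ hp) ^ R.A) (Finsupp.single (pieceSymbol R ϱ) 1)
  else
    if ∃ l, ϱ l = R.minus then
      (genPlusProd R c ϱ ^ R.A) (Finsupp.single (pieceSymbol R ϱ) 1)
    else
      Finsupp.single (pieceSymbol R ϱ) 1

/-- The change of coefficients along a map of coefficient algebras. -/
def mapCoeff (f : K →ₐ[ℂ] L) : (JSymbol d →₀ K) →+ (JSymbol d →₀ L) :=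
  Finsupp.mapRange.addMonoidHom (f : K →+ L)

lemma mapCoeff_single (f : K →ₐ[ℂ] L) (s : JSymbol d) (a : K) :
    mapCoeff f (Finsupp.single s a) = Finsupp.single s (f a) := by
  simp [mapCoeff]

lemma mapCoeff_smul (f : K →ₐ[ℂ] L) (a : K) (F : JSymbol d →₀ K) :
    mapCoeff f (a • F) = f a • mapCoeff f F := by
  ext s
  simp [mapCoeff]

/-- Two operators correspond to each other under a change of coefficients. -/
def Intertwines (f : K →ₐ[ℂ] L) (S : Module.End K (JSymbol d →₀ K))
    (T : Module.End L (JSymbol d →₀ L)) : Prop :=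
  ∀ F, mapCoeff f (S F) = T (mapCoeff f F)

lemma Intertwines.one (f : K →ₐ[ℂ] L) : Intertwines (d := d) f 1 1 := fun _ => rfl

lemma Intertwines.mul {f : K →ₐ[ℂ] L} {S S' : Module.End K (JSymbol d →₀ K)}
    {T T' : Module.End L (JSymbol d →₀ L)} (h : Intertwines f S T) (h' : Intertwines f S' T') :
    Intertwines f (S * S') (T * T') := fun F => by
  rw [Module.End.mul_apply, Module.End.mul_apply, h, h']

lemma Intertwines.pow {f : K →ₐ[ℂ] L} {S : Module.End K (JSymbol d →₀ K)}
    {T : Module.End L (JSymbol d →₀ L)} (h : Intertwines f S T) (n : ℕ) :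
    Intertwines f (S ^ n) (T ^ n) := by
  induction n with
  | zero => exact Intertwines.one f
  | succ n ih => rw [pow_succ, pow_succ]; exact ih.mul h

lemma Intertwines.list_prod {f : K →ₐ[ℂ] L} {n : ℕ} {S : Fin n → Module.End K (JSymbol d →₀ K)}
    {T : Fin n → Module.End L (JSymbol d →₀ L)} (h : ∀ i, Intertwines f (S i) (T i)) :
    Intertwines f (List.ofFn S).prod (List.ofFn T).prod := by
  induction n with
  | zero => simpa using Intertwines.one f
  | succ n ih =>
    simp only [List.ofFn_succ, List.prod_cons]
    exact (h 0).mul (ih fun i => h i.succ)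

lemma intertwines_linearCombination {f : K →ₐ[ℂ] L} {g : JSymbol d → JSymbol d →₀ K}
    {g' : JSymbol d → JSymbol d →₀ L} (h : ∀ s, mapCoeff f (g s) = g' s) :
    Intertwines f (Finsupp.linearCombination K g) (Finsupp.linearCombination L g') := fun F => by
  induction F using Finsupp.induction_linear with
  | zero => simp
  | add F G hF hG => simp only [map_add, hF, hG]
  | single s a =>
    rw [mapCoeff_single, Finsupp.linearCombination_single, Finsupp.linearCombination_single,
      mapCoeff_smul, h]

lemma intertwines_genPlus (f : K →ₐ[ℂ] L) (ν : Fin d → ℂ) (c : IBPCoeffs d K) (l : Fin d) :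
    Intertwines f (genPlus ν c l) (genPlus ν (c.map f) l) :=
  intertwines_linearCombination fun s => by
    simp only [genPlusSymbol, map_sub, mapCoeff_single, map_mul, AlgHom.commutes, IBPCoeffs.map]

lemma intertwines_genMinus (f : K →ₐ[ℂ] L) (ν : Fin d → ℂ) (c : IBPCoeffs d K) (l : Fin d) :
    Intertwines f (genMinus ν c l) (genMinus ν (c.map f) l) :=
  intertwines_linearCombination fun s => by
    simp only [genMinusSymbol, map_add, mapCoeff_single, map_mul, AlgHom.commutes, IBPCoeffs.map]

lemma intertwines_genPlusProd (f : K →ₐ[ℂ] L) {ν : Fin d → ℂ} {I : Type} [Fintype I]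
    (R : Choices ν I) (c : IBPCoeffs d K) (ϱ : Fin d → I) :
    Intertwines f (genPlusProd R c ϱ) (genPlusProd R (c.map f) ϱ) :=
  Intertwines.list_prod fun l => by
    split_ifs
    exacts [intertwines_genPlus f ν c l, Intertwines.one f]

lemma mapCoeff_genPiece (f : K →ₐ[ℂ] L) {ν : Fin d → ℂ} {I : Type} [Fintype I]
    (R : Choices ν I) (c : IBPCoeffs d K) (ϱ : Fin d → I) :
    mapCoeff f (genPiece R c ϱ) = genPiece R (c.map f) ϱ := by
  have h1 : mapCoeff f (Finsupp.single (pieceSymbol R ϱ) 1) =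
      Finsupp.single (pieceSymbol R ϱ) 1 := by rw [mapCoeff_single, map_one]
  unfold genPiece
  split_ifs with hp hm hm
  · rw [genMinusLevel, intertwines_linearCombination (fun s => by
      rw [(intertwines_genMinus f ν c _).pow, mapCoeff_single, map_one]),
      (intertwines_genPlusProd f R c ϱ).pow, h1]
    rfl
  · rw [(intertwines_genMinus f ν c _).pow, h1]
  · rw [(intertwines_genPlusProd f R c ϱ).pow, h1]
  · exact h1

end Ops

/-- The coefficient data of the formal partial integrations in the definition of the Bessel
function. -/
def formalCoeffs (ς : Fin (d + 1) → ℤˣ) : IBPCoeffs d ℂ[X] :=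
  ⟨fun l => C (rotCoeff (ς l) 0), fun l => C (rotCoeffInv (ς l) 0), X⟩

lemma opPlus_eq_genPlus (ν : Fin d → ℂ) (ς : Fin (d + 1) → ℤˣ) (l : Fin d) :
    opPlus ν ς l = genPlus ν (formalCoeffs ς) l := by
  refine congrArg (Finsupp.linearCombination ℂ[X]) (funext fun s => ?_)
  have e1 : (C (sgn (ς l.castSucc) * sgn (ς (Fin.last d))) : ℂ[X]) =
      C (rotCoeffInv (ς l.castSucc) 0) * C (rotCoeff (ς (Fin.last d)) 0) := by
    rw [← C_mul, rotCoeff_zero, rotCoeffInv_zero]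
    congr 1
    linear_combination (sgn (ς l.castSucc) * sgn (ς (Fin.last d))) * I_mul_I
  have e2 : (C (sgn (ς l.castSucc) * I * (ν l + (s.shift l : ℂ) + 1)) : ℂ[X]) =
      C (ν l + (s.shift l : ℂ) + 1) * C (rotCoeffInv (ς l.castSucc) 0) := by
    rw [← C_mul, rotCoeffInv_zero]
    congr 1
    ring
  have e3 : (C (sgn (ς l.castSucc) * I) : ℂ[X]) = C (rotCoeffInv (ς l.castSucc) 0) := by
    rw [rotCoeffInv_zero, mul_comm]
  rw [e1, e2, e3]
  rfl

lemma opMinus_eq_genMinus (ν : Fin d → ℂ) (ς : Fin (d + 1) → ℤˣ) (l : Fin d) :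
    opMinus ν ς l = genMinus ν (formalCoeffs ς) l := by
  refine congrArg (Finsupp.linearCombination ℂ[X]) (funext fun s => ?_)
  have e1 : (C (sgn (ς l.castSucc) * sgn (ς (Fin.last d))) : ℂ[X]) =
      C (rotCoeffInv (ς (Fin.last d)) 0) * C (rotCoeff (ς l.castSucc) 0) := by
    rw [← C_mul, rotCoeff_zero, rotCoeffInv_zero]
    congr 1
    linear_combination (sgn (ς l.castSucc) * sgn (ς (Fin.last d))) * I_mul_I
  have e2 : (C (sgn (ς (Fin.last d)) * I * (ν l + (s.shift l : ℂ) - 1)) : ℂ[X]) =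
      C (ν l + (s.shift l : ℂ) - 1) * C (rotCoeffInv (ς (Fin.last d)) 0) := by
    rw [← C_mul, rotCoeffInv_zero]
    congr 1
    ring
  have e3 : (C (sgn (ς (Fin.last d)) * I) : ℂ[X]) = C (rotCoeffInv (ς (Fin.last d)) 0) := by
    rw [rotCoeffInv_zero, mul_comm]
  rw [e1, e2, e3]
  rfl

lemma pieceFormal_eq_genPiece {ν : Fin d → ℂ} {I : Type} [Fintype I] (R : Choices ν I)
    (ς : Fin (d + 1) → ℤˣ) (ϱ : Fin d → I) :
    pieceFormal R ς ϱ = genPiece R (formalCoeffs ς) ϱ := by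
  unfold pieceFormal genPiece opMinusLevel genMinusLevel opPlusProd genPlusProd
  simp only [opPlus_eq_genPlus, opMinus_eq_genMinus]

/-! ### Convergence of the resulting integrals -/

/-- `h` vanishes near `0`. -/
def VanishesAtZero (h : ℝ → ℂ) : Prop := ∃ δ : ℝ, 0 < δ ∧ ∀ t, 0 < t → t < δ → h t = 0

/-- `h` vanishes near `∞`. -/
def VanishesAtTop (h : ℝ → ℂ) : Prop := ∃ T : ℝ, ∀ t, T < t → h t = 0

lemma VanishesAtZero.euler {h : ℝ → ℂ} (hh : VanishesAtZero h) :
    VanishesAtZero fun t => (t : ℂ) * deriv h t := by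
  obtain ⟨δ, hδ, h0⟩ := hh
  refine ⟨δ, hδ, fun t ht htδ => ?_⟩
  have : h =ᶠ[𝓝 t] fun _ => 0 := eventually_of_mem (Ioo_mem_nhds ht htδ) fun t ht => h0 t ht.1 ht.2
  simp [this.deriv_eq]

lemma VanishesAtTop.euler {h : ℝ → ℂ} (hh : VanishesAtTop h) :
    VanishesAtTop fun t => (t : ℂ) * deriv h t := by
  obtain ⟨T, h0⟩ := hh
  refine ⟨T, fun t ht => ?_⟩
  have : h =ᶠ[𝓝 t] fun _ => 0 := eventually_of_mem (Ioi_mem_nhds ht) h0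
  simp [this.deriv_eq]

lemma integrable_comp_exp_mul_cexp {h : ℝ → ℂ} (hh : IsT h) {z : ℂ}
    (h0 : 0 < z.re ∨ VanishesAtZero h) (h1 : z.re < 0 ∨ VanishesAtTop h) :
    Integrable fun u : ℝ => h (Real.exp u) * cexp (z * u) := by
  have hc : Continuous fun u : ℝ => h (Real.exp u) * cexp (z * u) :=
    hh.continuous_comp_exp.mul (by fun_prop)
  obtain ⟨B, hB⟩ := hh.exists_bound
  have hle : ∀ u : ℝ, ‖h (Real.exp u) * cexp (z * u)‖ ≤ B * Real.exp (z.re * u) := fun u => by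
    rw [norm_mul, Complex.norm_exp]
    simpa using mul_le_mul_of_nonneg_right (hB _ (Real.exp_pos u)) (Real.exp_pos _).le
  have hneg : IntegrableOn (fun u : ℝ => h (Real.exp u) * cexp (z * u)) (Iic 0) := by
    rcases h0 with h0 | ⟨δ, hδ, h0⟩
    · exact ((integrableOn_exp_mul_Iic h0 0).const_mul B).mono' hc.aestronglyMeasurable
        (Eventually.of_forall hle)
    · have e1 : IntegrableOn (fun u : ℝ => h (Real.exp u) * cexp (z * u)) (Iio (Real.log δ)) :=
        integrableOn_zero.congr_fun (fun u hu => by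
          rw [h0 _ (Real.exp_pos u) ((Real.lt_log_iff_exp_lt hδ).1 hu), zero_mul])
          measurableSet_Iio
      refine (e1.union (hc.continuousOn.integrableOn_Icc (a := Real.log δ) (b := 0))).mono_set ?_
      intro u hu
      exact (lt_or_ge u (Real.log δ)).imp id fun h => ⟨h, hu⟩
  have hpos : IntegrableOn (fun u : ℝ => h (Real.exp u) * cexp (z * u)) (Ioi 0) := by
    rcases h1 with h1 | ⟨T, h1⟩
    · exact ((integrableOn_exp_mul_Ioi h1 0).const_mul B).mono' hc.aestronglyMeasurable
        (Eventually.of_forall hle)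
    · have e1 : IntegrableOn (fun u : ℝ => h (Real.exp u) * cexp (z * u)) (Ioi T) :=
        integrableOn_zero.congr_fun (fun u hu => by
          rw [h1 _ (lt_of_lt_of_le hu (by linarith [Real.add_one_le_exp u])), zero_mul])
          measurableSet_Ioi
      refine ((hc.continuousOn.integrableOn_Icc (a := 0) (b := T)).union e1).mono_set ?_
      intro u hu
      exact (le_or_gt u T).imp (fun h => ⟨le_of_lt hu, h⟩) id
  rw [← integrableOn_univ, ← Iic_union_Ioi (a := (0 : ℝ))]
  exact hneg.union hpos

/-- The symbols whose integrand is absolutely integrable for a trivial reason: in each variable the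
power decays wherever the weight does not vanish. -/
def convergentSymbols (ν : Fin d → ℂ) : Set (JSymbol d) :=
  {s | ∀ l, IsT (s.amp l) ∧ (0 < (ν l + s.shift l).re ∨ VanishesAtZero (s.amp l)) ∧
    ((ν l + s.shift l).re < 0 ∨ VanishesAtTop (s.amp l))}

/-- The oscillating or decaying factor is bounded by `1` for angles in `[0, π]`, so that the
integrals of convergent symbols are dominated uniformly in the angles. -/
lemma norm_logAmp_mul_rotKernel_le (h : Fin d → ℝ → ℂ) (μ : Fin d → ℂ) (ς : Fin (d + 1) → ℤˣ)
    {φ : Fin (d + 1) → ℝ} (hφ : ∀ l, 0 ≤ Real.sin (φ l)) {x : ℝ} (hx : 0 ≤ x) (u : Fin d → ℝ) :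
    ‖logAmp h u * rotKernel μ ς φ x u‖ ≤ ‖∏ l, h l (Real.exp (u l)) * cexp (μ l * u l)‖ := by
  rw [Finset.prod_mul_distrib, norm_mul, norm_mul, ← Complex.exp_sum, norm_rotKernel,
    Complex.norm_exp]
  refine mul_le_mul_of_nonneg_left (Real.exp_le_exp.2 ?_) (norm_nonneg _)
  have := mul_nonneg hx ((zero_mul (phaseSize u)).symm.le.trans
    (mul_phaseSize_le_rotPhase_re ς hφ u))
  simp only [re_sum, re_mul_ofReal]
  linarith

lemma integrable_prod_of_mem_convergentSymbols {ν : Fin d → ℂ} {s : JSymbol d}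
    (hs : s ∈ convergentSymbols ν) :
    Integrable fun u : Fin d → ℝ =>
      ∏ l, s.amp l (Real.exp (u l)) * cexp ((ν l + s.shift l) * u l) :=
  Integrable.fintype_prod (f := fun l (u : ℝ) => s.amp l (Real.exp u) *
    cexp ((ν l + s.shift l) * u)) fun l =>
    integrable_comp_exp_mul_cexp (hs l).1 (hs l).2.1 (hs l).2.2

lemma integrableOn_jIntegrand {ν : Fin d → ℂ} {s : JSymbol d} (hs : s ∈ convergentSymbols ν)
    (ς : Fin (d + 1) → ℤˣ) {x : ℝ} (hx : 0 < x) :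
    IntegrableOn (jIntegrand ν ς s x) (orthant d) := by
  rw [integrableOn_jIntegrand_iff]
  have hc := continuous_logAmp fun l => (hs l).1
  exact (integrable_prod_of_mem_convergentSymbols hs).mono
    (Continuous.aestronglyMeasurable (by fun_prop))
    (Eventually.of_forall (norm_logAmp_mul_rotKernel_le s.amp _ ς (by simp) hx.le))

lemma tendsto_rotIntegral_zero {ν : Fin d → ℂ} {s : JSymbol d} (hs : s ∈ convergentSymbols ν)
    (ς : Fin (d + 1) → ℤˣ) {x : ℝ} (hx : 0 < x) :
    Tendsto (fun ε : ℝ => rotIntegral s.amp (fun l => ν l + s.shift l) ς (fun _ => ε) x) (𝓝[>] 0)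
      (𝓝 (jIntegral ν ς s x)) := by
  rw [jIntegral_eq_rotIntegral]
  have hc := continuous_logAmp fun l => (hs l).1
  refine tendsto_integral_filter_of_dominated_convergence _
    (Eventually.of_forall fun ε => Continuous.aestronglyMeasurable (by fun_prop))
    ?_ (integrable_prod_of_mem_convergentSymbols hs).norm ?_
  · filter_upwards [Ioo_mem_nhdsGT Real.pi_pos] with ε hε
    exact Eventually.of_forall (norm_logAmp_mul_rotKernel_le s.amp _ ς
      (fun _ => (Real.sin_pos_of_mem_Ioo hε).le) hx.le)
  · refine Eventually.of_forall fun u => Tendsto.const_mul _ ?_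
    have h1 : Continuous fun ε : ℝ => rotKernel (fun l => ν l + s.shift l) ς (fun _ => ε) x u :=
      (continuous_rotKernel_angle _ ς x u).comp (by fun_prop)
    exact (h1.tendsto 0).mono_left nhdsWithin_le_nhds

/-! ### The shifts produced by the formal partial integrations -/

section Shifts

variable {K : Type} [CommRing K]

lemma linearCombination_mem_supported {P Q : Set (JSymbol d)} {g : JSymbol d → JSymbol d →₀ K}
    (h : ∀ s ∈ P, g s ∈ Finsupp.supported K K Q) {F : JSymbol d →₀ K}
    (hF : F ∈ Finsupp.supported K K P) :
    Finsupp.linearCombination K g F ∈ Finsupp.supported K K Q := by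
  rw [Finsupp.linearCombination_apply]
  exact Submodule.sum_mem _ fun s hs => Submodule.smul_mem _ _ (h s (hF hs))

/-- The weights that arise from `h_ϱ` by Euler operators. -/
def pieceAmps {ν : Fin d → ℂ} {I : Type} [Fintype I] (R : Choices ν I) (ϱ : Fin d → I) :
    Set (Fin d → ℝ → ℂ) :=
  {h | ∀ l, IsT (h l) ∧ (ϱ l ≠ R.minus → VanishesAtZero (h l)) ∧
    (ϱ l ≠ R.plus → VanishesAtTop (h l))}

variable {ν : Fin d → ℂ} {I : Type} [Fintype I] (R : Choices ν I) (ϱ : Fin d → I)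

lemma eulerAmp_mem_pieceAmps {h : Fin d → ℝ → ℂ} (hh : h ∈ pieceAmps R ϱ) (l : Fin d) :
    eulerAmp l h ∈ pieceAmps R ϱ := fun k => by
  by_cases hkl : k = l
  · subst hkl
    simpa [eulerAmp] using
      And.intro (hh k).1.euler ⟨fun h => ((hh k).2.1 h).euler, fun h => ((hh k).2.2 h).euler⟩
  · simpa [eulerAmp, hkl] using hh k

lemma Choices.eq_zero_of_eq_one {i j : I} (hij : i ≠ j) {t : ℝ} (ht : 0 < t) (h1 : R.h j t = 1) :
    R.h i t = 0 := by
  classical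
  have h2 := R.h_sum t ht
  rw [← Finset.add_sum_erase _ _ (Finset.mem_univ j), h1, add_eq_left] at h2
  exact (Finset.sum_eq_zero_iff_of_nonneg fun k _ => R.h_nonneg k t ht).1 h2 i
    (Finset.mem_erase.2 ⟨hij, Finset.mem_univ _⟩)

lemma pieceSymbol_amp_mem : (pieceSymbol R ϱ).amp ∈ pieceAmps R ϱ := fun l => by
  refine ⟨R.h_mem _, fun hl => ?_, fun hl => ?_⟩
  · obtain ⟨δ, hδ, h1⟩ := R.h_minus
    exact ⟨δ, hδ, fun t ht htδ => by
      simp [pieceSymbol, R.eq_zero_of_eq_one hl ht (h1 t ht htδ)]⟩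
  · obtain ⟨T, h1⟩ := R.h_plus
    exact ⟨max T 0, fun t ht => by
      simp [pieceSymbol, R.eq_zero_of_eq_one hl ((le_max_right _ _).trans_lt ht)
        (h1 t ((le_max_left _ _).trans_lt ht))]⟩

/-- The symbols of index `n + k e^d`, `k ≥ 0`, with weights derived from `h_ϱ`. -/
def plusSymbols (n : Fin d → ℕ) : Set (JSymbol d) :=
  {s | s.amp ∈ pieceAmps R ϱ ∧ ∃ k : ℕ, ∀ l, s.shift l = n l + k}

/-- The symbols of index `m - N e^d - j e_l`, `j ≥ 0`, with weights derived from `h_ϱ`. -/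
def minusSymbols (m : Fin d → ℤ) (l : Fin d) (N : ℕ) : Set (JSymbol d) :=
  {s | s.amp ∈ pieceAmps R ϱ ∧
    ∃ j : ℕ, ∀ k, s.shift k = m k - N - if k = l then (j : ℤ) else 0}

lemma listProd_mem_supported {m : ℕ} {T : Fin m → Module.End K (JSymbol d →₀ K)}
    {v : Fin m → Fin d → ℕ}
    (h : ∀ i n, ∀ F ∈ Finsupp.supported K K (plusSymbols R ϱ n),
      T i F ∈ Finsupp.supported K K (plusSymbols R ϱ (n + v i)))
    (n : Fin d → ℕ) {F : JSymbol d →₀ K} (hF : F ∈ Finsupp.supported K K (plusSymbols R ϱ n)) :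
    (List.ofFn T).prod F ∈ Finsupp.supported K K (plusSymbols R ϱ (n + ∑ i, v i)) := by
  induction m with
  | zero => simpa using hF
  | succ m ih =>
    rw [List.ofFn_succ, List.prod_cons, Module.End.mul_apply, Fin.sum_univ_succ, add_comm (v 0),
      ← add_assoc]
    exact h 0 _ _ (ih fun i => h i.succ)

variable [Algebra ℂ K]

lemma genPlus_mem_supported (c : IBPCoeffs d K) (l : Fin d) (n : Fin d → ℕ)
    {F : JSymbol d →₀ K} (hF : F ∈ Finsupp.supported K K (plusSymbols R ϱ n)) :
    genPlus ν c l F ∈ Finsupp.supported K K (plusSymbols R ϱ (n + Pi.single l 1)) := by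
  refine linearCombination_mem_supported (fun s hs => ?_) hF
  obtain ⟨ha, k, hk⟩ := hs
  refine Submodule.sub_mem _ (Submodule.sub_mem _ ?_ ?_) ?_ <;>
    refine Finsupp.single_mem_supported _ _ ⟨?_, ?_⟩
  · exact ha
  · refine ⟨k + 1, fun i => ?_⟩
    by_cases hi : i = l
    · subst hi; simp [unitVec, hk]; ring
    · simp [unitVec, hk, hi]; ring
  · exact ha
  · refine ⟨k, fun i => ?_⟩
    by_cases hi : i = l
    · subst hi; simp [unitVec, hk]; ring
    · simp [unitVec, hk, hi]
  · exact eulerAmp_mem_pieceAmps R ϱ ha l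
  · refine ⟨k, fun i => ?_⟩
    by_cases hi : i = l
    · subst hi; simp [unitVec, hk]; ring
    · simp [unitVec, hk, hi]

lemma genMinus_pow_mem_supported (c : IBPCoeffs d K) (l : Fin d) {s : JSymbol d}
    (hs : s.amp ∈ pieceAmps R ϱ) (N : ℕ) :
    (genMinus ν c l ^ N) (Finsupp.single s 1) ∈
      Finsupp.supported K K (minusSymbols R ϱ s.shift l N) := by
  induction N with
  | zero => exact Finsupp.single_mem_supported _ _ ⟨hs, 0, fun k => by simp⟩
  | succ N ih =>
    rw [pow_succ', Module.End.mul_apply]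
    refine linearCombination_mem_supported (fun s' hs' => ?_) ih
    obtain ⟨ha, j, hj⟩ := hs'
    refine Submodule.add_mem _ (Submodule.add_mem _ ?_ ?_) ?_ <;>
      refine Finsupp.single_mem_supported _ _ ⟨?_, ?_⟩
    · exact ha
    · refine ⟨j + 1, fun i => ?_⟩
      by_cases hi : i = l
      · subst hi; simp [unitVec, hj]; ring
      · simp [unitVec, hj, hi]; ring
    · exact ha
    · refine ⟨j, fun i => ?_⟩
      simp [hj]; ring
    · exact eulerAmp_mem_pieceAmps R ϱ ha l
    · refine ⟨j, fun i => ?_⟩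
      simp [hj]; ring

open Classical in
/-- The indicator function of the set of coordinates at which `ϱ` is `-`. -/
def minusIndicator : Fin d → ℕ := fun l => if ϱ l = R.minus then 1 else 0

lemma genPlusProd_pow_mem_supported (c : IBPCoeffs d K) (N : ℕ) :
    (genPlusProd R c ϱ ^ N) (Finsupp.single (pieceSymbol R ϱ) 1) ∈
      Finsupp.supported K K (plusSymbols R ϱ (N • minusIndicator R ϱ)) := by
  classical
  induction N with
  | zero =>
    exact Finsupp.single_mem_supported _ _
      ⟨pieceSymbol_amp_mem R ϱ, 0, fun l => by simp [pieceSymbol]⟩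
  | succ N ih =>
    have hsum : ∑ l, (if ϱ l = R.minus then Pi.single l 1 else 0 : Fin d → ℕ) =
        minusIndicator R ϱ := by
      funext k
      rw [Finset.sum_apply, Finset.sum_eq_single k]
      · unfold minusIndicator; split_ifs <;> simp
      · intro l _ hl
        split_ifs <;> simp [hl.symm]
      · simp
    rw [pow_succ', Module.End.mul_apply, succ_nsmul, ← hsum]
    rw [← hsum] at ih
    refine listProd_mem_supported R ϱ (fun l n F hF => ?_) _ ih
    split_ifs
    · exact genPlus_mem_supported R ϱ c l n hF
    · simpa using hF

/-- As `A > |Re ν_l|`, a shift by at least `A` at the coordinates where `ϱ` is `-`, and by at most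
`-A` where it is `+`, suffices for convergence; at all other coordinates the weight has compact
support in `ℝ₊`. -/
lemma mem_convergentSymbols {s : JSymbol d} (ha : s.amp ∈ pieceAmps R ϱ)
    (hm : ∀ l, ϱ l = R.minus → (R.A : ℤ) ≤ s.shift l)
    (hp : ∀ l, ϱ l = R.plus → s.shift l ≤ -(R.A : ℤ)) : s ∈ convergentSymbols ν := fun l => by
  obtain ⟨a, haν, haA⟩ := R.A_large
  have h1 := abs_lt.1 (haν l)
  refine ⟨(ha l).1, ?_, ?_⟩
  · by_cases hl : ϱ l = R.minus
    · left
      have : (R.A : ℝ) ≤ s.shift l := by exact_mod_cast hm l hl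
      simp only [add_re, intCast_re]
      linarith [h1.1]
    · exact Or.inr ((ha l).2.1 hl)
  · by_cases hl : ϱ l = R.plus
    · left
      have : (s.shift l : ℝ) ≤ -R.A := by exact_mod_cast hp l hl
      simp only [add_re, intCast_re]
      linarith [h1.2]
    · exact Or.inr ((ha l).2.2 hl)

/-- The powers of the formal partial integrations are chosen so that all resulting integrals
converge absolutely. -/
lemma genPiece_mem_supported (c : IBPCoeffs d K) :
    genPiece R c ϱ ∈ Finsupp.supported K K (convergentSymbols ν) := by
  unfold genPiece
  split_ifs with hp hm hm
  · have hl := R.lplus_mem ϱ hp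
    set l₀ := R.lplus ϱ hp
    refine linearCombination_mem_supported (fun s hs => ?_)
      (genPlusProd_pow_mem_supported R ϱ c (2 * R.A))
    obtain ⟨ha, k, hk⟩ := hs
    -- `ϱ` is not `-` at `l₀`, so the shift at `l₀` counts the additions of the all-ones vector.
    have hk₀ : s.shift l₀ = k := by
      simp [hk, minusIndicator, hl, R.minus_ne_plus.symm]
    refine Finsupp.supported_mono (fun s' hs' => ?_) (genMinus_pow_mem_supported R ϱ c l₀ ha _)
    obtain ⟨ha', j, hj⟩ := hs'
    refine mem_convergentSymbols R ϱ ha' (fun l hl' => ?_) (fun l hl' => ?_)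
    · have hne : l ≠ l₀ := fun h => R.minus_ne_plus (by rw [← hl', h, hl])
      simp [hj, hk₀, hk, minusIndicator, hl', hne]
      linarith
    · have h0 : minusIndicator R ϱ l = 0 := by simp [minusIndicator, hl', R.minus_ne_plus.symm]
      simp only [hj, hk₀, hk]
      split_ifs <;> simp [h0]
  · refine Finsupp.supported_mono (fun s' hs' => ?_)
      (genMinus_pow_mem_supported R ϱ c _ (pieceSymbol_amp_mem R ϱ) _)
    obtain ⟨ha', j, hj⟩ := hs'
    refine mem_convergentSymbols R ϱ ha' (fun l hl' => absurd ⟨l, hl'⟩ hm) (fun l hl' => ?_)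
    rw [hj]
    simp only [pieceSymbol]
    split_ifs <;> simp
  · refine Finsupp.supported_mono (fun s hs => ?_) (genPlusProd_pow_mem_supported R ϱ c R.A)
    obtain ⟨ha, k, hk⟩ := hs
    refine mem_convergentSymbols R ϱ ha (fun l hl' => ?_) (fun l hl' => absurd ⟨l, hl'⟩ hp)
    simp [hk, minusIndicator, hl']
  · exact Finsupp.single_mem_supported _ _ (mem_convergentSymbols R ϱ (pieceSymbol_amp_mem R ϱ)
      (fun l hl' => absurd ⟨l, hl'⟩ hm) (fun l hl' => absurd ⟨l, hl'⟩ hp))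

end Shifts

/-! ### The Bessel function as a limit of regularized integrals -/

/-- The coefficient data of the partial integrations that are valid for a rotated phase. -/
def angleCoeffs (ς : Fin (d + 1) → ℤˣ) (φ : Fin (d + 1) → ℝ) (x : ℝ) : IBPCoeffs d ℂ :=
  ⟨fun l => rotCoeff (ς l) (φ l), fun l => rotCoeffInv (ς l) (φ l), (x : ℂ)⁻¹⟩

/-- The value of a formal linear combination, with every integral taken with rotated phase. -/
def rotValue (ν : Fin d → ℂ) (ς : Fin (d + 1) → ℤˣ) (φ : Fin (d + 1) → ℝ) (x : ℝ) :
    (JSymbol d →₀ ℂ) →ₗ[ℂ] ℂ :=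
  Finsupp.linearCombination ℂ fun s => rotIntegral s.amp (fun l => ν l + s.shift l) ς φ x

/-- The symbols with weights in `𝒯(ℝ₊)`. -/
def smoothSymbols (d : ℕ) : Set (JSymbol d) := {s | ∀ l, IsT (s.amp l)}

/-- The operator preserves the values of combinations of symbols with weights in `𝒯(ℝ₊)`. -/
def PreservesValue (ν : Fin d → ℂ) (ς : Fin (d + 1) → ℤˣ) (φ : Fin (d + 1) → ℝ) (x : ℝ)
    (T : Module.End ℂ (JSymbol d →₀ ℂ)) : Prop :=
  ∀ F ∈ Finsupp.supported ℂ ℂ (smoothSymbols d),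
    T F ∈ Finsupp.supported ℂ ℂ (smoothSymbols d) ∧ rotValue ν ς φ x (T F) = rotValue ν ς φ x F

section Values

variable {ν : Fin d → ℂ} {ς : Fin (d + 1) → ℤˣ} {φ : Fin (d + 1) → ℝ} {x : ℝ}

lemma PreservesValue.one : PreservesValue ν ς φ x 1 := fun _ hF => ⟨hF, rfl⟩

lemma PreservesValue.mul {S T : Module.End ℂ (JSymbol d →₀ ℂ)} (hS : PreservesValue ν ς φ x S)
    (hT : PreservesValue ν ς φ x T) : PreservesValue ν ς φ x (S * T) := fun F hF =>
  ⟨(hS _ (hT F hF).1).1, (hS _ (hT F hF).1).2.trans (hT F hF).2⟩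

lemma PreservesValue.pow {T : Module.End ℂ (JSymbol d →₀ ℂ)} (hT : PreservesValue ν ς φ x T)
    (n : ℕ) : PreservesValue ν ς φ x (T ^ n) := by
  induction n with
  | zero => exact PreservesValue.one
  | succ n ih => rw [pow_succ]; exact ih.mul hT

lemma PreservesValue.list_prod {n : ℕ} {T : Fin n → Module.End ℂ (JSymbol d →₀ ℂ)}
    (hT : ∀ i, PreservesValue ν ς φ x (T i)) : PreservesValue ν ς φ x (List.ofFn T).prod := by
  induction n with
  | zero => simpa using PreservesValue.one
  | succ n ih =>
    simp only [List.ofFn_succ, List.prod_cons]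
    exact (hT 0).mul (ih fun i => hT i.succ)

lemma rotValue_apply (F : JSymbol d →₀ ℂ) : rotValue ν ς φ x F =
    F.sum fun s a => a * rotIntegral s.amp (fun l => ν l + s.shift l) ς φ x := by
  rw [rotValue, Finsupp.linearCombination_apply]
  rfl

lemma rotValue_single (s : JSymbol d) (a : ℂ) : rotValue ν ς φ x (Finsupp.single s a) =
    a * rotIntegral s.amp (fun l => ν l + s.shift l) ς φ x := by
  rw [rotValue, Finsupp.linearCombination_single, smul_eq_mul]

lemma preservesValue_linearCombination {g : JSymbol d → JSymbol d →₀ ℂ}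
    (hg : ∀ s ∈ smoothSymbols d, g s ∈ Finsupp.supported ℂ ℂ (smoothSymbols d) ∧
      rotValue ν ς φ x (g s) = rotValue ν ς φ x (Finsupp.single s 1)) :
    PreservesValue ν ς φ x (Finsupp.linearCombination ℂ g) := fun F hF => by
  refine ⟨linearCombination_mem_supported (fun s hs => (hg s hs).1) hF, ?_⟩
  rw [Finsupp.linearCombination_apply, map_finsuppSum, rotValue_apply]
  refine Finset.sum_congr rfl fun s hs => ?_
  simp only [map_smul, (hg s (hF hs)).2, rotValue_single, one_mul, smul_eq_mul]

lemma preservesValue_genPlus (hφ : ∀ l, 0 < Real.sin (φ l)) (hx : 0 < x) (l : Fin d) :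
    PreservesValue ν ς φ x (genPlus ν (angleCoeffs ς φ x) l) := by
  refine preservesValue_linearCombination fun s hs => ⟨?_, ?_⟩
  · refine Submodule.sub_mem _ (Submodule.sub_mem _ ?_ ?_) ?_ <;>
      refine Finsupp.single_mem_supported _ _ ?_
    exacts [hs, hs, fun k => IsT.eulerAmp hs l k]
  · have hx' : (x : ℂ) ≠ 0 := by exact_mod_cast hx.ne'
    set μ : Fin d → ℂ := fun l => ν l + s.shift l with hμ
    have h1 : (fun k => ν k + ((s.shift + 1 + unitVec l) k : ℤ)) = μ + Pi.single l 1 + 1 := by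
      funext k
      by_cases hk : k = l
      · subst hk; simp [unitVec, hμ]; ring
      · simp [unitVec, hμ, hk]; ring
    have h2 : (fun k => ν k + ((s.shift + unitVec l) k : ℤ)) = μ + Pi.single l 1 := by
      funext k
      by_cases hk : k = l
      · subst hk; simp [unitVec, hμ]; ring
      · simp [unitVec, hμ, hk]
    have key := rotIntegral_eulerAmp hs (μ + Pi.single l 1) ς hφ hx l
    have hl : (μ + Pi.single l 1 : Fin d → ℂ) l = μ l + 1 := by simp
    rw [add_sub_cancel_right, hl] at key
    have hinv := rotCoeffInv_mul_rotCoeff (ς l.castSucc) (φ l.castSucc)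
    simp only [genPlusSymbol, map_sub, rotValue_single, h1, h2, key, angleCoeffs,
      Algebra.algebraMap_self, RingHom.id_apply]
    have hμl : ν l + (s.shift l : ℂ) = μ l := rfl
    rw [hμl, one_mul, ← hμ]
    field_simp
    linear_combination x * rotIntegral s.amp μ ς φ x * hinv

lemma preservesValue_genMinus (hφ : ∀ l, 0 < Real.sin (φ l)) (hx : 0 < x) (l : Fin d) :
    PreservesValue ν ς φ x (genMinus ν (angleCoeffs ς φ x) l) := by
  refine preservesValue_linearCombination fun s hs => ⟨?_, ?_⟩
  · refine Submodule.add_mem _ (Submodule.add_mem _ ?_ ?_) ?_ <;>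
      refine Finsupp.single_mem_supported _ _ ?_
    exacts [hs, hs, fun k => IsT.eulerAmp hs l k]
  · have hx' : (x : ℂ) ≠ 0 := by exact_mod_cast hx.ne'
    set μ : Fin d → ℂ := fun l => ν l + s.shift l with hμ
    have h1 : (fun k => ν k + ((s.shift - 1 - unitVec l) k : ℤ)) = μ - 1 - Pi.single l 1 := by
      funext k
      by_cases hk : k = l
      · subst hk; simp [unitVec, hμ]; ring
      · simp [unitVec, hμ, hk]; ring
    have h2 : (fun k => ν k + ((s.shift - 1) k : ℤ)) = μ - 1 := by
      funext k
      simp [hμ]; ring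
    have key := rotIntegral_eulerAmp hs (μ - 1) ς hφ hx l
    have hl : (μ - 1) l = μ l - 1 := by simp
    rw [sub_add_cancel, hl] at key
    have hinv := rotCoeffInv_mul_rotCoeff (ς (Fin.last d)) (φ (Fin.last d))
    simp only [genMinusSymbol, map_add, rotValue_single, h1, h2, key, angleCoeffs,
      Algebra.algebraMap_self, RingHom.id_apply]
    have hμl : ν l + (s.shift l : ℂ) = μ l := rfl
    rw [hμl, one_mul, ← hμ]
    field_simp
    linear_combination x * rotIntegral s.amp μ ς φ x * hinv

lemma preservesValue_genMinusLevel (hφ : ∀ l, 0 < Real.sin (φ l)) (hx : 0 < x) (A : ℕ)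
    (l : Fin d) : PreservesValue ν ς φ x (genMinusLevel ν (angleCoeffs ς φ x) A l) := by
  unfold genMinusLevel
  exact preservesValue_linearCombination fun s hs =>
    (preservesValue_genMinus hφ hx l).pow (A + (s.shift l).toNat) _
      (Finsupp.single_mem_supported ℂ 1 hs)

lemma preservesValue_genPlusProd {I : Type} [Fintype I] (R : Choices ν I)
    (hφ : ∀ l, 0 < Real.sin (φ l)) (hx : 0 < x) (ϱ : Fin d → I) :
    PreservesValue ν ς φ x (genPlusProd R (angleCoeffs ς φ x) ϱ) := by
  unfold genPlusProd
  refine PreservesValue.list_prod fun l => ?_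
  split_ifs
  exacts [preservesValue_genPlus hφ hx l, PreservesValue.one]

lemma rotValue_genPiece {I : Type} [Fintype I] (R : Choices ν I) (hφ : ∀ l, 0 < Real.sin (φ l))
    (hx : 0 < x) (ϱ : Fin d → I) :
    rotValue ν ς φ x (genPiece R (angleCoeffs ς φ x) ϱ) =
      rotIntegral (pieceSymbol R ϱ).amp ν ς φ x := by
  have hs : Finsupp.single (pieceSymbol R ϱ) (1 : ℂ) ∈
      Finsupp.supported ℂ ℂ (smoothSymbols d) :=
    Finsupp.single_mem_supported _ _ fun l => (pieceSymbol_amp_mem R ϱ l).1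
  have h0 : rotValue ν ς φ x (Finsupp.single (pieceSymbol R ϱ) 1) =
      rotIntegral (pieceSymbol R ϱ).amp ν ς φ x := by
    simp [rotValue_single, pieceSymbol]
  have hP := fun n => (preservesValue_genPlusProd R hφ hx ϱ (ς := ς)).pow n _ hs
  rw [← h0]
  unfold genPiece
  split_ifs with hp hm hm
  · rw [(preservesValue_genMinusLevel hφ hx _ _ _ (hP _).1).2, (hP _).2]
  · exact ((preservesValue_genMinus hφ hx _).pow _ _ hs).2
  · exact (hP _).2
  · rfl

end Values

/-- The coefficient data for equal angles, as continuous functions of the angle. -/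
def deformedCoeffs (ς : Fin (d + 1) → ℤˣ) (x : ℝ) : IBPCoeffs d C(ℝ, ℂ) :=
  ⟨fun l => ⟨rotCoeff (ς l), continuous_rotCoeff _⟩,
    fun l => ⟨rotCoeffInv (ς l), continuous_rotCoeffInv _⟩, ContinuousMap.const ℝ (x : ℂ)⁻¹⟩

lemma deformedCoeffs_map_eval (ς : Fin (d + 1) → ℤˣ) (x ε : ℝ) :
    (deformedCoeffs ς x).map (ContinuousMap.evalAlgHom ℂ ℂ ε) =
      angleCoeffs ς (fun _ => ε) x := rfl

lemma formalCoeffs_map_aeval (ς : Fin (d + 1) → ℤˣ) (x : ℝ) :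
    (formalCoeffs ς).map (aeval (x : ℂ)⁻¹) = angleCoeffs ς (fun _ => 0) x := by
  simp [formalCoeffs, IBPCoeffs.map, angleCoeffs]

lemma rotValue_mapCoeff {K : Type} [CommRing K] [Algebra ℂ K] (f : K →ₐ[ℂ] ℂ) (ν : Fin d → ℂ)
    (ς : Fin (d + 1) → ℤˣ) (φ : Fin (d + 1) → ℝ) (x : ℝ) (F : JSymbol d →₀ K) :
    rotValue ν ς φ x (mapCoeff f F) =
      F.sum fun s a => f a * rotIntegral s.amp (fun l => ν l + s.shift l) ς φ x := by
  rw [rotValue, Finsupp.linearCombination_apply, mapCoeff, Finsupp.mapRange.addMonoidHom_apply]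
  exact Finsupp.sum_mapRange_index fun s => zero_smul _ _

lemma evalJ_eq_rotValue (ν : Fin d → ℂ) (ς : Fin (d + 1) → ℤˣ) (F : JSpace d) (x : ℝ) :
    evalJ ν ς F x = rotValue ν ς (fun _ => 0) x (mapCoeff (aeval (x : ℂ)⁻¹) F) := by
  rw [rotValue_mapCoeff, evalJ]
  simp only [jIntegral_eq_rotIntegral, Polynomial.coe_aeval_eq_eval]
  rfl

lemma tendsto_rotIntegral_piece {ν : Fin d → ℂ} {I : Type} [Fintype I] (R : Choices ν I)
    (ς : Fin (d + 1) → ℤˣ) (ϱ : Fin d → I) {x : ℝ} (hx : 0 < x) :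
    Tendsto (fun ε : ℝ => rotIntegral (pieceSymbol R ϱ).amp ν ς (fun _ => ε) x) (𝓝[>] 0)
      (𝓝 (evalJ ν ς (pieceFormal R ς ϱ) x)) := by
  set F := genPiece R (deformedCoeffs ς x) ϱ with hF
  have h1 : Tendsto (fun ε : ℝ => rotValue ν ς (fun _ => ε) x
      (mapCoeff (ContinuousMap.evalAlgHom ℂ ℂ ε) F)) (𝓝[>] 0)
      (𝓝 (rotValue ν ς (fun _ => 0) x (mapCoeff (ContinuousMap.evalAlgHom ℂ ℂ 0) F))) := by
    simp only [rotValue_mapCoeff]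
    refine tendsto_finsetSum _ fun s hs => Tendsto.mul ?_ ?_
    · exact ((F s).continuous.tendsto 0).mono_left nhdsWithin_le_nhds
    · have := tendsto_rotIntegral_zero (genPiece_mem_supported R ϱ (deformedCoeffs ς x) hs) ς hx
      rw [jIntegral_eq_rotIntegral] at this
      exact this
  have h2 : evalJ ν ς (pieceFormal R ς ϱ) x =
      rotValue ν ς (fun _ => 0) x (mapCoeff (ContinuousMap.evalAlgHom ℂ ℂ 0) F) := by
    rw [evalJ_eq_rotValue, pieceFormal_eq_genPiece, mapCoeff_genPiece, formalCoeffs_map_aeval,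
      hF, mapCoeff_genPiece, deformedCoeffs_map_eval]
  rw [h2]
  refine h1.congr' ?_
  filter_upwards [Ioo_mem_nhdsGT Real.pi_pos] with ε hε
  rw [hF, mapCoeff_genPiece, deformedCoeffs_map_eval,
    rotValue_genPiece R (fun _ => Real.sin_pos_of_mem_Ioo hε) hx]

lemma sum_rotIntegral_piece {ν : Fin d → ℂ} {I : Type} [Fintype I] (R : Choices ν I)
    (ς : Fin (d + 1) → ℤˣ) {φ : Fin (d + 1) → ℝ} (hφ : ∀ l, 0 < Real.sin (φ l)) {x : ℝ}
    (hx : 0 < x) : ∑ ϱ : Fin d → I, rotIntegral (pieceSymbol R ϱ).amp ν ς φ x =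
      rotIntegral (fun _ _ => 1) ν ς φ x := by
  classical
  simp only [rotIntegral]
  rw [← integral_finsetSum _ fun ϱ _ => integrable_logAmp_mul_rotKernel
    (fun l => (pieceSymbol_amp_mem R ϱ l).1) ν ς hφ hx]
  refine integral_congr_ae (Eventually.of_forall fun u => ?_)
  simp only [← Finset.sum_mul]
  congr 1
  simp only [logAmp, pieceSymbol, Finset.prod_const_one]
  rw [← Fintype.prod_sum fun l ϱ => ((R.h ϱ (Real.exp (u l)) : ℝ) : ℂ)]
  refine Finset.prod_eq_one fun l _ => ?_
  exact_mod_cast R.h_sum _ (Real.exp_pos (u l))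

lemma tendsto_rotIntegral_besselJ {ν : Fin d → ℂ} {I : Type} [Fintype I] (R : Choices ν I)
    (ς : Fin (d + 1) → ℤˣ) {x : ℝ} (hx : 0 < x) :
    Tendsto (fun ε : ℝ => rotIntegral (fun _ _ => 1) ν ς (fun _ => ε) x) (𝓝[>] 0)
      (𝓝 (besselJ R ς x)) := by
  classical
  have h1 := tendsto_finsetSum Finset.univ fun (ϱ : Fin d → I) _ =>
    tendsto_rotIntegral_piece R ς ϱ hx
  have h2 : besselJ R ς x = ∑ ϱ : Fin d → I, evalJ ν ς (pieceFormal R ς ϱ) x := by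
    unfold besselJ
    refine Finset.sum_congr ?_ fun _ _ => rfl
    ext; simp
  rw [h2]
  refine h1.congr' ?_
  filter_upwards [Ioo_mem_nhdsGT Real.pi_pos] with ε hε
  exact sum_rotIntegral_piece R ς (fun _ => Real.sin_pos_of_mem_Ioo hε) hx

/-! ### Rotation of the contour -/

lemma rotIntegral_one (μ : Fin d → ℂ) (ς : Fin (d + 1) → ℤˣ) (φ : Fin (d + 1) → ℝ) (x : ℝ) :
    rotIntegral (fun _ _ => 1) μ ς φ x = ∫ u : Fin d → ℝ, rotKernel μ ς φ x u := by
  simp [rotIntegral, logAmp]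

lemma integrable_rotKernel (μ : Fin d → ℂ) (ς : Fin (d + 1) → ℤˣ) {φ : Fin (d + 1) → ℝ}
    (hφ : ∀ l, 0 < Real.sin (φ l)) {x : ℝ} (hx : 0 < x) : Integrable (rotKernel μ ς φ x) := by
  simpa [logAmp] using integrable_logAmp_mul_rotKernel (fun _ : Fin d => isT_one) μ ς hφ hx

/-- The recurrence relation among the rotated integrals without weight. -/
lemma integral_rotKernel_recurrence (μ : Fin d → ℂ) (ς : Fin (d + 1) → ℤˣ)
    {φ : Fin (d + 1) → ℝ} (hφ : ∀ l, 0 < Real.sin (φ l)) {x : ℝ} (hx : 0 < x) (l : Fin d) :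
    μ l * ∫ u, rotKernel μ ς φ x u =
      x * rotCoeff (ς (Fin.last d)) (φ (Fin.last d)) * (∫ u, rotKernel (μ + 1) ς φ x u) -
      x * rotCoeff (ς l.castSucc) (φ l.castSucc) *
        ∫ u, rotKernel (μ - Pi.single l 1) ς φ x u := by
  have key := rotIntegral_eulerAmp (fun _ : Fin d => isT_one) μ ς hφ hx l
  have h0 : rotIntegral (eulerAmp l fun _ _ => 1) μ ς φ x = 0 := by
    have : ∀ u : Fin d → ℝ, logAmp (eulerAmp l fun _ _ => 1) u = 0 := fun u =>
      Finset.prod_eq_zero (Finset.mem_univ l) (by simp [eulerAmp])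
    simp [rotIntegral, this]
  rw [h0] at key
  simp only [rotIntegral_one] at key
  linear_combination key

/-- The derivative of the rotated phase when the angles move with velocity `ψ`. -/
def rotPhaseDeriv (ς : Fin (d + 1) → ℤˣ) (φ ψ : Fin (d + 1) → ℝ) (u : Fin d → ℝ) : ℂ :=
  ψ (Fin.last d) * (I * sgn (ς (Fin.last d)) * rotCoeff (ς (Fin.last d)) (φ (Fin.last d))) *
      cexp (∑ l, (u l : ℂ)) +
    ∑ l : Fin d, ψ l.castSucc *
      (I * sgn (ς l.castSucc) * rotCoeff (ς l.castSucc) (φ l.castSucc)) * cexp (-(u l : ℂ))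

lemma hasDerivAt_rotPhase (ς : Fin (d + 1) → ℤˣ) (φ ψ : Fin (d + 1) → ℝ) (u : Fin d → ℝ)
    (τ : ℝ) :
    HasDerivAt (fun τ : ℝ => rotPhase ς (φ + τ • ψ) u) (rotPhaseDeriv ς (φ + τ • ψ) ψ u) τ := by
  have h1 : ∀ l, HasDerivAt (fun τ : ℝ => rotCoeff (ς l) ((φ + τ • ψ) l))
      (ψ l * (I * sgn (ς l) * rotCoeff (ς l) ((φ + τ • ψ) l))) τ := fun l => by
    have h2 : HasDerivAt (fun τ : ℝ => φ l + τ * ψ l) (1 * ψ l) τ :=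
      ((hasDerivAt_id τ).mul_const (ψ l)).const_add (φ l)
    have h3 := HasDerivAt.scomp τ (hasDerivAt_rotCoeff (ς l) (φ l + τ * ψ l)) h2
    simpa [Function.comp_def] using h3
  unfold rotPhase rotPhaseDeriv
  exact ((h1 _).mul_const _).fun_add (HasDerivAt.fun_sum fun l _ => (h1 _).mul_const _)

lemma norm_sgn (s : ℤˣ) : ‖sgn s‖ = 1 := by
  rcases sgn_eq s with h | h <;> simp [h]

lemma norm_rotPhaseDeriv_le (ς : Fin (d + 1) → ℤˣ) (φ ψ : Fin (d + 1) → ℝ) (u : Fin d → ℝ) :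
    ‖rotPhaseDeriv ς φ ψ u‖ ≤ ‖ψ‖ * phaseSize u := by
  have h1 : cexp (∑ l, (u l : ℂ)) = ((Real.exp (∑ l, u l) : ℝ) : ℂ) := by push_cast; rfl
  have h2 : ∀ l, cexp (-(u l : ℂ)) = ((Real.exp (-u l) : ℝ) : ℂ) := fun l => by push_cast; rfl
  have h3 : ∀ l, ‖(ψ l : ℂ) * (I * sgn (ς l) * rotCoeff (ς l) (φ l))‖ ≤ ‖ψ‖ := fun l => by
    simpa [norm_sgn, norm_rotCoeff] using norm_le_pi_norm ψ l
  unfold rotPhaseDeriv phaseSize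
  rw [mul_add, Finset.mul_sum]
  refine (norm_add_le _ _).trans (add_le_add ?_ ((norm_sum_le _ _).trans (Finset.sum_le_sum ?_)))
  · rw [norm_mul, h1, norm_real, Real.norm_of_nonneg (Real.exp_pos _).le]
    gcongr
    exact h3 _
  · intro l _
    rw [norm_mul, h2, norm_real, Real.norm_of_nonneg (Real.exp_pos _).le]
    gcongr
    exact h3 _

lemma continuous_rotPhaseDeriv (ς : Fin (d + 1) → ℤˣ) (φ ψ : Fin (d + 1) → ℝ) :
    Continuous (rotPhaseDeriv ς φ ψ) := by
  unfold rotPhaseDeriv; fun_prop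

/-- Moving the angles compatibly is a complex translation of `u`, so it changes the integral only
by the factor that comes from the power function. Compatibility means that the angle of
`t₁ ⋯ t_d` is the sum of the angles by which the variables `t_l` are rotated. -/
lemma hasDerivAt_integral_rotKernel_angle (ν : Fin d → ℂ) (ς : Fin (d + 1) → ℤˣ)
    (φ ψ : Fin (d + 1) → ℝ)
    (hψ : sgn (ς (Fin.last d)) * ψ (Fin.last d) = -∑ l : Fin d, sgn (ς l.castSucc) * ψ l.castSucc)
    {x : ℝ} (hx : 0 < x) {S : Set ℝ} (hS : IsOpen S) {κ : ℝ} (hκ : 0 < κ)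
    (hsin : ∀ τ ∈ S, ∀ l, κ ≤ Real.sin ((φ + τ • ψ) l)) {τ : ℝ} (hτ : τ ∈ S) :
    HasDerivAt (fun τ : ℝ => ∫ u, rotKernel ν ς (φ + τ • ψ) x u)
      (I * (∑ l : Fin d, ν l * (sgn (ς l.castSucc) * ψ l.castSucc)) *
        ∫ u, rotKernel ν ς (φ + τ • ψ) x u) τ := by
  set r := ∑ k, |(ν k).re| with hr
  have hν : ∀ l, |(ν l).re| ≤ r := fun l =>
    Finset.single_le_sum (f := fun k => |(ν k).re|) (fun _ _ => abs_nonneg _) (Finset.mem_univ l)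
  have hpos : ∀ l, 0 < Real.sin ((φ + τ • ψ) l) := fun l => hκ.trans_le (hsin τ hτ l)
  have hder : ∀ u τ, HasDerivAt (fun τ : ℝ => rotKernel ν ς (φ + τ • ψ) x u)
      (rotKernel ν ς (φ + τ • ψ) x u * -(x * rotPhaseDeriv ς (φ + τ • ψ) ψ u)) τ := fun u τ =>
    (((hasDerivAt_rotPhase ς φ ψ u τ).const_mul (x : ℂ)).const_sub _).cexp
  have hcont := continuous_rotPhaseDeriv ς (φ + τ • ψ) ψ
  have h := hasDerivAt_integral_of_dominated_loc_of_deriv_le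
    (μ := (volume : Measure (Fin d → ℝ))) (F := fun τ u => rotKernel ν ς (φ + τ • ψ) x u)
    (F' := fun τ u => rotKernel ν ς (φ + τ • ψ) x u * -(x * rotPhaseDeriv ς (φ + τ • ψ) ψ u))
    (bound := fun u => x * ‖ψ‖ * (phaseSize u ^ 1 *
      Real.exp (d * r * ‖u‖ - x * κ * phaseSize u))) (hS.mem_nhds hτ)
    (Eventually.of_forall fun τ => (continuous_rotKernel _ _ _ _).aestronglyMeasurable)
    (integrable_rotKernel ν ς hpos hx)
    (Continuous.aestronglyMeasurable (by fun_prop))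
    (Eventually.of_forall fun u τ hτ => by
      have h1 := norm_rotKernel_le hν ς (hsin τ hτ) hx.le u
      have h2 := norm_rotPhaseDeriv_le ς (φ + τ • ψ) ψ u
      rw [norm_mul, norm_neg, norm_mul, norm_real, Real.norm_of_nonneg hx.le]
      calc _ ≤ Real.exp (d * r * ‖u‖ - x * κ * phaseSize u) * (x * (‖ψ‖ * phaseSize u)) := by
            gcongr
        _ = _ := by ring)
    ((integrable_phaseSize_pow_mul_exp 1 _ (mul_pos hx hκ)).const_mul _)
    (Eventually.of_forall fun u τ _ => hder u τ)
  convert! h.2 using 1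
  -- The derivative is a combination of the partial integrations in the variables `u_l`.
  have i1 := integrable_rotKernel (ν + 1) ς hpos hx
  have i2 := fun l : Fin d => integrable_rotKernel (ν - Pi.single l 1) ς hpos hx
  have hrec := fun l => integral_rotKernel_recurrence ν ς hpos hx l
  set Φ := φ + τ • ψ
  have hsplit : ∀ u, rotKernel ν ς Φ x u * -(x * rotPhaseDeriv ς Φ ψ u) =
      -(x * (ψ (Fin.last d) * (I * sgn (ς (Fin.last d)) *
        rotCoeff (ς (Fin.last d)) (Φ (Fin.last d))))) * rotKernel (ν + 1) ς Φ x u +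
      ∑ l : Fin d, -(x * (ψ l.castSucc * (I * sgn (ς l.castSucc) *
        rotCoeff (ς l.castSucc) (Φ l.castSucc)))) * rotKernel (ν - Pi.single l 1) ς Φ x u := by
    intro u
    simp only [rotKernel_add_one, rotKernel_sub_single, rotPhaseDeriv]
    rw [mul_add, neg_add, mul_add, Finset.mul_sum, ← Finset.sum_neg_distrib, Finset.mul_sum]
    congr 1
    · ring
    · exact Finset.sum_congr rfl fun l _ => by ring
  simp only [hsplit]
  rw [integral_add (i1.const_mul _) (integrable_finsetSum _ fun l _ => (i2 l).const_mul _),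
    integral_finsetSum _ fun l _ => (i2 l).const_mul _]
  simp only [integral_const_mul]
  have hterm : ∀ l : Fin d, -(x * (ψ l.castSucc * (I * sgn (ς l.castSucc) *
        rotCoeff (ς l.castSucc) (Φ l.castSucc)))) * (∫ u, rotKernel (ν - Pi.single l 1) ς Φ x u) =
      I * (ν l * (sgn (ς l.castSucc) * ψ l.castSucc)) * (∫ u, rotKernel ν ς Φ x u) -
      (sgn (ς l.castSucc) * ψ l.castSucc) * (I * x * rotCoeff (ς (Fin.last d)) (Φ (Fin.last d)) *
        ∫ u, rotKernel (ν + 1) ς Φ x u) := fun l => by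
    linear_combination (-(I * (sgn (ς l.castSucc) * ψ l.castSucc))) * hrec l
  rw [Finset.sum_congr rfl fun l _ => hterm l, Finset.sum_sub_distrib, ← Finset.sum_mul,
    ← Finset.sum_mul, ← Finset.mul_sum]
  linear_combination (-(I * x * rotCoeff (ς (Fin.last d)) (Φ (Fin.last d)) *
        ∫ u, rotKernel (ν + 1) ς Φ x u)) * (-hψ)

/-- The factor by which rotation of the contour multiplies the power function. -/
def rotFactor (ν : Fin d → ℂ) (ς : Fin (d + 1) → ℤˣ) (ψ : Fin (d + 1) → ℝ) : ℂ :=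
  cexp (-(I * ∑ l : Fin d, ν l * (sgn (ς l.castSucc) * ψ l.castSucc)))

lemma integral_rotKernel_eq_rotFactor_mul (ν : Fin d → ℂ) (ς : Fin (d + 1) → ℤˣ)
    {ψ : Fin (d + 1) → ℝ}
    (hψ : sgn (ς (Fin.last d)) * ψ (Fin.last d) = -∑ l : Fin d, sgn (ς l.castSucc) * ψ l.castSucc)
    (hψ0 : ∀ l, 0 < ψ l) (hψ1 : ∀ l, ψ l ≤ 1 / 2) {x : ℝ} (hx : 0 < x) {ε : ℝ} (hε0 : 0 < ε)
    (hε1 : ε ≤ 1 / 4) :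
    ∫ u, rotKernel ν ς (fun _ => ε) x u =
      rotFactor ν ς ψ * ∫ u, rotKernel ν ς ((fun _ => ε) + ψ) x u := by
  set a : ℂ := I * ∑ l : Fin d, ν l * (sgn (ς l.castSucc) * ψ l.castSucc) with ha
  have hpi := Real.one_le_pi_div_two
  have hsin : ∀ τ ∈ Ioo (-ε) (1 + ε), ∀ l,
      Real.sin (ε / 2) ≤ Real.sin (((fun _ => ε : Fin (d + 1) → ℝ) + τ • ψ) l) := by
    intro τ hτ l
    have h1 : -ε * (1 / 2) ≤ τ * ψ l := by
      rcases le_or_gt 0 τ with h | h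
      · nlinarith [mul_nonneg h (hψ0 l).le]
      · nlinarith [hψ1 l, hψ0 l, hτ.1]
    have h2 : τ * ψ l ≤ (1 + ε) * (1 / 2) := by
      rcases le_or_gt 0 τ with h | h
      · nlinarith [hψ1 l, hψ0 l, hτ.2]
      · nlinarith [mul_pos (neg_pos.2 h) (hψ0 l)]
    change Real.sin (ε / 2) ≤ Real.sin (ε + τ * ψ l)
    refine Real.sin_le_sin_of_le_of_le_pi_div_two ?_ ?_ ?_ <;> linarith
  have hκ : 0 < Real.sin (ε / 2) := Real.sin_pos_of_pos_of_lt_pi (by linarith) (by linarith)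
  have hd : ∀ τ ∈ Ioo (-ε) (1 + ε), HasDerivAt (fun τ : ℝ => cexp (-((τ : ℂ) * a)) *
      ∫ u, rotKernel ν ς ((fun _ => ε) + τ • ψ) x u) 0 τ := fun τ hτ => by
    have h1 := hasDerivAt_integral_rotKernel_angle ν ς (fun _ => ε) ψ hψ hx isOpen_Ioo hκ hsin hτ
    have h2 : HasDerivAt (fun τ : ℝ => cexp (-((τ : ℂ) * a)))
        (cexp (-((τ : ℂ) * a)) * -(1 * a)) τ :=
      ((Complex.ofRealCLM.hasDerivAt (x := τ)).mul_const a).fun_neg.cexp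
    convert! h2.fun_mul h1 using 1
    rw [← ha]
    ring
  have h := isOpen_Ioo.is_const_of_deriv_eq_zero isPreconnected_Ioo
    (fun τ hτ => (hd τ hτ).differentiableAt.differentiableWithinAt) (fun τ hτ => (hd τ hτ).deriv)
    (x := 0) (y := 1) ⟨by linarith, by linarith⟩ ⟨by linarith, by linarith⟩
  simpa [rotFactor, ha] using h

/-- The Bessel function is an absolutely convergent integral over the rotated orthant. -/
lemma besselJ_eq_rotFactor_mul {ν : Fin d → ℂ} {I : Type} [Fintype I] (R : Choices ν I)
    (ς : Fin (d + 1) → ℤˣ) {ψ : Fin (d + 1) → ℝ}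
    (hψ : sgn (ς (Fin.last d)) * ψ (Fin.last d) = -∑ l : Fin d, sgn (ς l.castSucc) * ψ l.castSucc)
    (hψ0 : ∀ l, 0 < ψ l) (hψ1 : ∀ l, ψ l ≤ 1 / 2) {x : ℝ} (hx : 0 < x) :
    besselJ R ς x = rotFactor ν ς ψ * ∫ u, rotKernel ν ς ψ x u := by
  have hpi := Real.one_le_pi_div_two
  obtain ⟨l₀, hl₀⟩ := Finite.exists_min ψ
  have hκ : 0 < Real.sin (ψ l₀) :=
    Real.sin_pos_of_pos_of_lt_pi (hψ0 _) (by linarith [hψ1 l₀])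
  have hν : ∀ l, |(ν l).re| ≤ ∑ k, |(ν k).re| := fun l =>
    Finset.single_le_sum (f := fun k => |(ν k).re|) (fun _ _ => abs_nonneg _) (Finset.mem_univ l)
  have hlim : Tendsto (fun ε : ℝ => ∫ u, rotKernel ν ς ((fun _ => ε) + ψ) x u) (𝓝[>] 0)
      (𝓝 (∫ u, rotKernel ν ς ψ x u)) := by
    refine tendsto_integral_filter_of_dominated_convergence _
      (Eventually.of_forall fun ε => (continuous_rotKernel _ _ _ _).aestronglyMeasurable) ?_
      (integrable_exp_norm_sub_phaseSize (d * ∑ k, |(ν k).re|) (mul_pos hx hκ)) ?_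
    · filter_upwards [Ioo_mem_nhdsGT (show (0 : ℝ) < 1 / 4 by norm_num)] with ε hε
      refine Eventually.of_forall (norm_rotKernel_le hν ς (fun l => ?_) hx.le)
      change Real.sin (ψ l₀) ≤ Real.sin (ε + ψ l)
      refine Real.sin_le_sin_of_le_of_le_pi_div_two ?_ ?_ ?_ <;>
        linarith [hψ0 l₀, hl₀ l, hψ1 l, hε.1, hε.2]
    · refine Eventually.of_forall fun u => ?_
      have h1 : Continuous fun ε : ℝ => rotKernel ν ς ((fun _ => ε) + ψ) x u :=
        (continuous_rotKernel_angle _ ς x u).comp (by fun_prop)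
      have h2 := (h1.tendsto 0).mono_left (nhdsWithin_le_nhds (s := Ioi 0))
      have h3 : (fun _ => (0 : ℝ)) + ψ = ψ := zero_add ψ
      rwa [h3] at h2
  refine tendsto_nhds_unique (tendsto_rotIntegral_besselJ R ς hx)
    ((hlim.const_mul _).congr' ?_)
  filter_upwards [Ioo_mem_nhdsGT (show (0 : ℝ) < 1 / 4 by norm_num)] with ε hε
  rw [rotIntegral_one, integral_rotKernel_eq_rotFactor_mul ν ς hψ hψ0 hψ1 hx hε.1 hε.2.le]

/-! ### Derivatives in `x` -/

lemma contDiffOn_infty_of_hasDerivAt_seq {f : ℕ → ℝ → ℂ} {S : Set ℝ} (hS : IsOpen S)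
    (hf : ∀ j, ∀ x ∈ S, HasDerivAt (f j) (f (j + 1) x) x) : ContDiffOn ℝ ∞ (f 0) S := by
  have h : ∀ n j : ℕ, ContDiffOn ℝ n (f j) S := by
    intro n
    induction n with
    | zero =>
      exact fun j => contDiffOn_zero.2 fun x hx => (hf j x hx).continuousAt.continuousWithinAt
    | succ n ih =>
      intro j
      push_cast
      refine (contDiffOn_succ_iff_deriv_of_isOpen hS).2
        ⟨fun x hx => (hf j x hx).differentiableAt.differentiableWithinAt, by simp, ?_⟩
      exact (ih (j + 1)).congr fun x hx => (hf j x hx).deriv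
  exact contDiffOn_infty.2 fun n => h n 0

lemma iteratedDeriv_eq_of_hasDerivAt_seq {f : ℕ → ℝ → ℂ} {S : Set ℝ} (hS : IsOpen S)
    (hf : ∀ j, ∀ x ∈ S, HasDerivAt (f j) (f (j + 1) x) x) (j : ℕ) :
    ∀ x ∈ S, iteratedDeriv j (f 0) x = f j x := by
  induction j with
  | zero => simp
  | succ j ih =>
    intro x hx
    have he : iteratedDeriv j (f 0) =ᶠ[𝓝 x] f j := eventually_of_mem (hS.mem_nhds hx) ih
    rw [iteratedDeriv_succ, he.deriv_eq, (hf j x hx).deriv]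

/-- The `j`-th derivative in `x` of the integral of `rotKernel`. -/
def kernelDeriv (ν : Fin d → ℂ) (ς : Fin (d + 1) → ℤˣ) (φ : Fin (d + 1) → ℝ) (j : ℕ) (x : ℝ) :
    ℂ :=
  ∫ u, rotKernel ν ς φ x u * (-rotPhase ς φ u) ^ j

lemma norm_rotKernel_mul_pow_le {ν : Fin d → ℂ} {r : ℝ} (hν : ∀ l, |(ν l).re| ≤ r)
    (ς : Fin (d + 1) → ℤˣ) {φ : Fin (d + 1) → ℝ} {κ : ℝ} (hφ : ∀ l, κ ≤ Real.sin (φ l))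
    {x : ℝ} (hx : 0 ≤ x) (j : ℕ) (u : Fin d → ℝ) :
    ‖rotKernel ν ς φ x u * (-rotPhase ς φ u) ^ j‖ ≤
      phaseSize u ^ j * Real.exp (d * r * ‖u‖ - x * κ * phaseSize u) := by
  rw [norm_mul, norm_pow, norm_neg, mul_comm]
  exact mul_le_mul (pow_le_pow_left₀ (norm_nonneg _) (norm_rotPhase_le ς φ u) j)
    (norm_rotKernel_le hν ς hφ hx u) (norm_nonneg _) (pow_nonneg (phaseSize_pos u).le j)

lemma hasDerivAt_kernelDeriv (ν : Fin d → ℂ) (ς : Fin (d + 1) → ℤˣ) {φ : Fin (d + 1) → ℝ}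
    {κ : ℝ} (hκ : 0 < κ) (hφ : ∀ l, κ ≤ Real.sin (φ l)) (j : ℕ) {x : ℝ} (hx : 0 < x) :
    HasDerivAt (kernelDeriv ν ς φ j) (kernelDeriv ν ς φ (j + 1) x) x := by
  have hν : ∀ l, |(ν l).re| ≤ ∑ k, |(ν k).re| := fun l =>
    Finset.single_le_sum (f := fun k => |(ν k).re|) (fun _ _ => abs_nonneg _) (Finset.mem_univ l)
  have hint : ∀ (j : ℕ) (y : ℝ), 0 < y → Integrable fun u : Fin d → ℝ =>
      phaseSize u ^ j * Real.exp (d * (∑ k, |(ν k).re|) * ‖u‖ - y * κ * phaseSize u) :=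
    fun j y hy => integrable_phaseSize_pow_mul_exp j _ (mul_pos hy hκ)
  have hder : ∀ u (y : ℝ), HasDerivAt (fun y : ℝ => rotKernel ν ς φ y u * (-rotPhase ς φ u) ^ j)
      (rotKernel ν ς φ y u * (-rotPhase ς φ u) ^ (j + 1)) y := fun u y => by
    have h1 : HasDerivAt (fun y : ℝ => rotKernel ν ς φ y u)
        (rotKernel ν ς φ y u * -(1 * rotPhase ς φ u)) y :=
      (((Complex.ofRealCLM.hasDerivAt (x := y)).mul_const (rotPhase ς φ u)).const_sub _).cexp
    convert! h1.mul_const ((-rotPhase ς φ u) ^ j) using 1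
    ring
  refine (hasDerivAt_integral_of_dominated_loc_of_deriv_le
    (μ := (volume : Measure (Fin d → ℝ))) (Ioi_mem_nhds (half_lt_self hx))
    (Eventually.of_forall fun y => Continuous.aestronglyMeasurable (by fun_prop))
    ((hint j x hx).mono' (Continuous.aestronglyMeasurable (by fun_prop))
      (Eventually.of_forall (norm_rotKernel_mul_pow_le hν ς hφ hx.le j)))
    (Continuous.aestronglyMeasurable (by fun_prop))
    (Eventually.of_forall fun u y hy => ?_) (hint (j + 1) (x / 2) (half_pos hx))
    (Eventually.of_forall fun u y _ => hder u y)).2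
  refine (norm_rotKernel_mul_pow_le hν ς hφ ((half_pos hx).trans hy).le (j + 1) u).trans ?_
  have h1 := phaseSize_pos u
  have h2 : x / 2 ≤ y := le_of_lt hy
  gcongr

/-- The Bessel function is smooth, and its derivatives are rotated integrals. -/
lemma contDiffOn_besselJ_and_iteratedDeriv {ν : Fin d → ℂ} {I : Type} [Fintype I]
    (R : Choices ν I) (ς : Fin (d + 1) → ℤˣ) {ψ : Fin (d + 1) → ℝ}
    (hψ : sgn (ς (Fin.last d)) * ψ (Fin.last d) = -∑ l : Fin d, sgn (ς l.castSucc) * ψ l.castSucc)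
    (hψ0 : ∀ l, 0 < ψ l) (hψ1 : ∀ l, ψ l ≤ 1 / 2) : ContDiffOn ℝ ∞ (besselJ R ς) (Ioi 0) ∧
    ∀ j x, 0 < x → iteratedDeriv j (besselJ R ς) x = rotFactor ν ς ψ * kernelDeriv ν ς ψ j x := by
  have hpi := Real.one_le_pi_div_two
  obtain ⟨l₀, hl₀⟩ := Finite.exists_min ψ
  have hκ : 0 < Real.sin (ψ l₀) :=
    Real.sin_pos_of_pos_of_lt_pi (hψ0 _) (by linarith [hψ1 l₀])
  have hsin : ∀ l, Real.sin (ψ l₀) ≤ Real.sin (ψ l) := fun l =>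
    Real.sin_le_sin_of_le_of_le_pi_div_two (by linarith [hψ0 l₀]) (by linarith [hψ1 l]) (hl₀ l)
  have hd : ∀ j, ∀ x ∈ Ioi (0 : ℝ), HasDerivAt
      (fun x => rotFactor ν ς ψ * kernelDeriv ν ς ψ j x)
      (rotFactor ν ς ψ * kernelDeriv ν ς ψ (j + 1) x) x := fun j x hx =>
    (hasDerivAt_kernelDeriv ν ς hκ hsin j hx).const_mul _
  have he : ∀ x ∈ Ioi (0 : ℝ), besselJ R ς x = rotFactor ν ς ψ * kernelDeriv ν ς ψ 0 x :=
    fun x hx => by simpa [kernelDeriv] using besselJ_eq_rotFactor_mul R ς hψ hψ0 hψ1 hx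
  refine ⟨(contDiffOn_infty_of_hasDerivAt_seq isOpen_Ioi hd).congr he, fun j x hx => ?_⟩
  rw [← iteratedDeriv_eq_of_hasDerivAt_seq isOpen_Ioi hd j x hx]
  have he' : besselJ R ς =ᶠ[𝓝 x] fun x => rotFactor ν ς ψ * kernelDeriv ν ς ψ 0 x :=
    eventually_of_mem (Ioi_mem_nhds hx) he
  exact he'.iteratedDeriv_eq j

/-! ### The choice of angles and the final estimate -/

/-- If some sign `ς_l` differs from `ς_{d+1}`, then rotating that variable by `d` times the angle
`δ` of the other variables gives compatible angles that are all positive and comparable to `δ`. -/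
lemma exists_compatible_angles (ς : Fin (d + 1) → ℤˣ)
    (hς : ∃ l : Fin d, ς l.castSucc ≠ ς (Fin.last d)) {δ : ℝ} (hδ : 0 < δ) :
    ∃ ψ : Fin (d + 1) → ℝ,
      sgn (ς (Fin.last d)) * ψ (Fin.last d) = -∑ l : Fin d, sgn (ς l.castSucc) * ψ l.castSucc ∧
      ∀ l, δ ≤ ψ l ∧ ψ l ≤ 2 * d * δ := by
  obtain ⟨l₀, hl₀⟩ := hς
  have hd : (1 : ℝ) ≤ d := by exact_mod_cast (Fin.pos l₀ : 0 < d)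
  set ψ₀ : Fin d → ℝ := fun l => if l = l₀ then d * δ else δ with hψ₀
  set σ : Fin d → ℝ := fun l => (((ς (Fin.last d) * ς l.castSucc : ℤˣ) : ℤ) : ℝ) with hσ
  have hσ1 : ∀ l, σ l = 1 ∨ σ l = -1 := fun l => by
    rcases Int.units_eq_one_or (ς (Fin.last d) * ς l.castSucc) with h | h <;>
      simp only [hσ, h] <;> simp
  have hσ0 : σ l₀ = -1 := by
    have : ς (Fin.last d) * ς l₀.castSucc = -1 := by
      rcases Int.units_eq_one_or (ς (Fin.last d)) with h | h <;>
        rcases Int.units_eq_one_or (ς l₀.castSucc) with h' | h' <;> simp_all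
    simp only [hσ, this]
    simp
  -- The angle of `t₁ ⋯ t_d` is `d δ` from the rotated variable, plus `d - 1` terms `±δ`.
  have hlow : δ ≤ ∑ l, -(σ l * ψ₀ l) := by
    have h1 : ∑ l, ((if l = l₀ then (d + 1) * δ else 0) - δ) ≤ ∑ l, -(σ l * ψ₀ l) := by
      refine Finset.sum_le_sum fun l _ => ?_
      by_cases h : l = l₀
      · subst h; simp [hψ₀, hσ0]; linarith
      · rcases hσ1 l with h' | h' <;> simp [hψ₀, h, h']; linarith
    simp [Finset.sum_sub_distrib] at h1
    rw [Finset.sum_neg_distrib]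
    linarith
  have hup : ∑ l, -(σ l * ψ₀ l) ≤ 2 * d * δ := by
    have h1 : ∑ l, -(σ l * ψ₀ l) ≤ ∑ l, ((if l = l₀ then (d - 1) * δ else 0) + δ) := by
      refine Finset.sum_le_sum fun l _ => ?_
      by_cases h : l = l₀
      · subst h; simp [hψ₀, hσ0]; linarith
      · rcases hσ1 l with h' | h' <;> simp [hψ₀, h, h']; linarith
    simp [Finset.sum_add_distrib] at h1
    rw [Finset.sum_neg_distrib]
    linarith
  refine ⟨Fin.snoc ψ₀ (∑ l, -(σ l * ψ₀ l)), ?_, fun l => ?_⟩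
  · simp only [Fin.snoc_last, Fin.snoc_castSucc, Complex.ofReal_sum, Complex.ofReal_neg,
      Complex.ofReal_mul, Finset.mul_sum, ← Finset.sum_neg_distrib]
    refine Finset.sum_congr rfl fun l _ => ?_
    have h1 : ((σ l : ℝ) : ℂ) = sgn (ς (Fin.last d)) * sgn (ς l.castSucc) := by
      simp [hσ, sgn]
    rw [h1]
    linear_combination (-(sgn (ς l.castSucc) * ψ₀ l)) * sgn_mul_self (ς (Fin.last d))
  · refine Fin.lastCases ?_ (fun l => ?_) l
    · simpa using ⟨hlow.trans_eq (by simp), hup.trans_eq' (by simp)⟩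
    · simp only [Fin.snoc_castSucc, hψ₀]
      split_ifs <;> constructor <;> nlinarith

lemma abs_re_le_frakR (ν : Fin d → ℂ) (l : Fin d) : |(ν l).re| ≤ frakR ν :=
  le_ciSup (f := fun l => |(ν l).re|) (Finite.bddAbove_range _) l

lemma norm_add_one_le_frakC (ν : Fin d → ℂ) (l : Fin d) : ‖ν l‖ + 1 ≤ frakC ν :=
  add_le_add_left (le_ciSup (f := fun l => ‖ν l‖) (Finite.bddAbove_range _) l) 1

lemma one_le_frakC (ν : Fin d → ℂ) : 1 ≤ frakC ν :=
  le_add_of_nonneg_left (Real.iSup_nonneg fun _ => norm_nonneg _)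

lemma norm_rotFactor_le (ν : Fin d → ℂ) (ς : Fin (d + 1) → ℤˣ) {ψ : Fin (d + 1) → ℝ} {η : ℝ}
    (hψ0 : ∀ l, 0 ≤ ψ l) (hη : ∀ l, ψ l ≤ η) :
    ‖rotFactor ν ς ψ‖ ≤ Real.exp (d * (frakC ν * η)) := by
  unfold rotFactor
  refine (Complex.norm_exp_le_exp_norm _).trans (Real.exp_le_exp.2 ?_)
  rw [norm_neg, norm_mul, Complex.norm_I, one_mul]
  refine (norm_sum_le _ _).trans ?_
  have h : ∀ l ∈ (Finset.univ : Finset (Fin d)),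
      ‖ν l * (sgn (ς l.castSucc) * ψ l.castSucc)‖ ≤ frakC ν * η := fun l _ => by
    rw [norm_mul, norm_mul, norm_sgn, one_mul, norm_real, Real.norm_of_nonneg (hψ0 _)]
    have := norm_add_one_le_frakC ν l
    exact mul_le_mul (by linarith) (hη _) (hψ0 _) (by linarith [norm_nonneg (ν l)])
  simpa using Finset.sum_le_card_nsmul _ _ _ h

/-- The implied constant in the estimate of the derivatives of the Bessel function. -/
def besselBound (d : ℕ) (r : ℝ) (M j : ℕ) : ℝ :=
  Real.exp (d / 2) * (M.factorial * (16 * d) ^ M * ∫ u : Fin d → ℝ, phaseSize u ^ j *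
    Real.exp (d * r * ‖u‖ - 1 / (16 * d) * phaseSize u))

/-- Angles of size comparable to `1 / 𝔠` keep the factor from the power function bounded, while
the integrand decays like `exp (-c (x / 𝔠) (t₁ ⋯ t_d + ∑ t_l⁻¹))`. -/
lemma norm_iteratedDeriv_besselJ_le {ν : Fin d → ℂ} {ς : Fin (d + 1) → ℤˣ}
    (hς : ∃ l : Fin d, ς l.castSucc ≠ ς (Fin.last d)) {I : Type} [Fintype I] (R : Choices ν I)
    (M j : ℕ) {x : ℝ} (hx : frakC ν ≤ x) :
    ‖iteratedDeriv j (besselJ R ς) x‖ ≤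
      besselBound d (frakR ν) M j * (frakC ν / x) ^ M := by
  unfold besselBound
  have hd : (1 : ℝ) ≤ d := by exact_mod_cast (Fin.pos hς.choose : 0 < d)
  have hc := one_le_frakC ν
  set c := frakC ν with hcdef
  have hx0 : 0 < x := by linarith
  obtain ⟨ψ, hψ, hb⟩ := exists_compatible_angles ς hς (δ := 1 / (4 * d * c)) (by positivity)
  have hη : 2 * (d : ℝ) * (1 / (4 * d * c)) = 1 / (2 * c) := by field_simp; norm_num
  simp only [hη] at hb
  have hψ0 : ∀ l, 0 < ψ l := fun l => lt_of_lt_of_le (by positivity) (hb l).1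
  have hψ1 : ∀ l, ψ l ≤ 1 / 2 := fun l => (hb l).2.trans (by
    rw [div_le_div_iff₀ (by positivity) (by positivity)]; linarith)
  have hsin : ∀ l, 1 / (8 * d * c) ≤ Real.sin (ψ l) := fun l => by
    have hpi := Real.one_le_pi_div_two
    have h1 := Real.mul_le_sin (hψ0 l).le (by linarith [hψ1 l])
    have h2 : 1 / 2 * ψ l ≤ 2 / Real.pi * ψ l := by
      have : 1 / 2 ≤ 2 / Real.pi := by
        rw [div_le_div_iff₀ (by norm_num) Real.pi_pos]; linarith [Real.pi_le_four]
      exact mul_le_mul_of_nonneg_right this (hψ0 l).le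
    have h3 : 1 / (8 * d * c) = 1 / 2 * (1 / (4 * d * c)) := by field_simp; norm_num
    linarith [(hb l).1]
  rw [(contDiffOn_besselJ_and_iteratedDeriv R ς hψ hψ0 hψ1).2 j x hx0, norm_mul, mul_assoc]
  have hfac : ‖rotFactor ν ς ψ‖ ≤ Real.exp (d / 2) :=
    (norm_rotFactor_le ν ς (fun l => (hψ0 l).le) fun l => (hb l).2).trans
      (Real.exp_le_exp.2 (le_of_eq (by rw [← hcdef]; field_simp)))
  refine mul_le_mul hfac ?_ (norm_nonneg _) (Real.exp_pos _).le
  set y := x / c with hy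
  have hy1 : 1 ≤ y := (one_le_div (by linarith)).2 hx
  have hd16 : (0 : ℝ) < 1 / (16 * d) := by positivity
  have hint := integrable_phaseSize_pow_mul_exp (d := d) j (d * frakR ν) hd16
  -- Half of the exponential decay is spent on `y`, the other half on the convergence.
  have hpt : ∀ u : Fin d → ℝ, ‖rotKernel ν ς ψ x u * (-rotPhase ς ψ u) ^ j‖ ≤
      Real.exp (-(1 / (16 * d) * y)) * (phaseSize u ^ j *
        Real.exp (d * frakR ν * ‖u‖ - 1 / (16 * d) * phaseSize u)) := fun u => by
    refine (norm_rotKernel_mul_pow_le (abs_re_le_frakR ν) ς hsin hx0.le j u).trans ?_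
    rw [mul_left_comm, ← Real.exp_add]
    refine mul_le_mul_of_nonneg_left (Real.exp_le_exp.2 ?_) (pow_nonneg (phaseSize_pos u).le j)
    have h1 : x * (1 / (8 * d * c)) * phaseSize u = 1 / (16 * d) * (2 * (y * phaseSize u)) := by
      rw [hy]; field_simp; ring
    have h2 : y + phaseSize u ≤ 2 * (y * phaseSize u) := by
      nlinarith [one_le_phaseSize u]
    have h3 := mul_le_mul_of_nonneg_left h2 hd16.le
    rw [h1]
    linarith
  have hker : ‖kernelDeriv ν ς ψ j x‖ ≤ Real.exp (-(1 / (16 * d) * y)) *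
      ∫ u : Fin d → ℝ, phaseSize u ^ j *
        Real.exp (d * frakR ν * ‖u‖ - 1 / (16 * d) * phaseSize u) := by
    rw [← integral_const_mul]
    exact norm_integral_le_of_norm_le (hint.const_mul _) (Eventually.of_forall hpt)
  have hexp : Real.exp (-(1 / (16 * d) * y)) ≤ M.factorial * (16 * d) ^ M * (c / x) ^ M := by
    have h1 := Real.pow_div_factorial_le_exp (1 / (16 * d) * y) (by positivity) M
    rw [Real.exp_neg]
    refine (inv_anti₀ (by positivity) h1).trans (le_of_eq ?_)
    rw [inv_div, mul_assoc, ← mul_pow, div_eq_mul_inv, ← inv_pow]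
    congr 2
    rw [hy]
    field_simp
  refine hker.trans ((mul_le_mul_of_nonneg_right hexp (integral_nonneg fun u =>
    mul_nonneg (pow_nonneg (phaseSize_pos u).le j) (Real.exp_pos _).le)).trans (le_of_eq (by ring)))

end FundBessel

end

theorem theorem5 (d : ℕ) :
    (∀ (r : ℝ) (M j : ℕ), ∃ C : ℝ,
      ∀ (ν : Fin d → ℂ) (ς : Fin (d + 1) → ℤˣ),
        FundBessel.frakR ν = r →
        (∃ l : Fin d, ς l.castSucc ≠ ς (Fin.last d)) →
        ∀ (I : Type) [Fintype I] (R : FundBessel.Choices ν I) (x : ℝ),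
          FundBessel.frakC ν ≤ x →
          ‖iteratedDeriv j (FundBessel.besselJ R ς) x‖ ≤ C * (FundBessel.frakC ν / x) ^ M) ∧
    (∀ (ν : Fin d → ℂ) (ς : Fin (d + 1) → ℤˣ),
      (∃ l : Fin d, ς l.castSucc ≠ ς (Fin.last d)) →
      ∀ (I : Type) [Fintype I] (R : FundBessel.Choices ν I),
        (∀ (ϱ : Fin d → I), ∀ s ∈ (FundBessel.pieceFormal R ς ϱ).support, ∀ x : ℝ, 0 < x →
          MeasureTheory.IntegrableOn (FundBessel.jIntegrand ν ς s x) (FundBessel.orthant d)) ∧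
        ContDiffOn ℝ ∞ (FundBessel.besselJ R ς) (Set.Ioi 0) ∧
        ∀ j N : ℕ, Asymptotics.IsBigO Filter.atTop
          (iteratedDeriv j (FundBessel.besselJ R ς)) (fun x : ℝ => (x ^ N)⁻¹)) := by
  refine ⟨fun r M j => ⟨FundBessel.besselBound d r M j, fun ν ς hr hς I _ R x hx => ?_⟩,
    fun ν ς hς I _ R => ⟨?_, ?_, ?_⟩⟩
  · have h := FundBessel.norm_iteratedDeriv_besselJ_le hς R M j hx
    rw [hr] at h
    exact h
  · intro ϱ s hs x hx
    rw [FundBessel.pieceFormal_eq_genPiece] at hs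
    exact FundBessel.integrableOn_jIntegrand (FundBessel.genPiece_mem_supported R ϱ _ hs) ς hx
  · have hd : (1 : ℝ) ≤ d := by exact_mod_cast (Fin.pos hς.choose : 0 < d)
    obtain ⟨ψ, hψ, hb⟩ := FundBessel.exists_compatible_angles ς hς (δ := 1 / (4 * d))
      (by positivity)
    refine (FundBessel.contDiffOn_besselJ_and_iteratedDeriv R ς hψ
      (fun l => lt_of_lt_of_le (by positivity) (hb l).1)
      fun l => (hb l).2.trans (le_of_eq ?_)).1
    field_simp
    norm_num
  · intro j N
    refine Asymptotics.IsBigO.of_bound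
      (FundBessel.besselBound d (FundBessel.frakR ν) N j * FundBessel.frakC ν ^ N) ?_
    filter_upwards [Filter.eventually_ge_atTop (FundBessel.frakC ν)] with x hx
    refine (FundBessel.norm_iteratedDeriv_besselJ_le hς R N j hx).trans (le_of_eq ?_)
    have hx0 : 0 < x := lt_of_lt_of_le one_pos ((FundBessel.one_le_frakC ν).trans hx)
    rw [Real.norm_of_nonneg (by positivity), div_pow, div_eq_mul_inv, ← mul_assoc]
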